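/- Let $d,k\ge 1$ be integers and let $s_1,\dots,s_k\ge d$ be real numbers. Write $\mathrm{Herm}_d$ for the real vector space of $d\times d$ complex Hermitian matrices. A random matrix $W\in\mathrm{Herm}_d$ is a Wishart matrix of parameters $(d,s)$ if, for an integer $s$, $W$ is distributed as $G^*G$, where $G$ is an $s\times d$ matrix with i.i.d. standard complex Gaussian entries, or if, for a real $s\ge d$, $W$ has a density with respect to Lebesgue measure on $\mathrm{Herm}_d$ that is proportional to $\mathbf 1_{w\ge 0}\,e^{-\operatorname{Tr} w}\det(w)^{s-d}$. A Wishart-random POVM of parameters $(d,k;s_1,\dots,s_k)$ is a random $k$-tuple $M=(M_1,\dots,M_k)$ with $M_i=S^{-1/2}W_iS^{-1/2}$ almost surely, where $S=\sum_{j=1}^k W_j$ and $W_1,\dots,W_k$ are independent Wishart matrices of parameters $(d,s_1),\dots,(d,s_k)$ (and $S^{-1/2}$ is taken in the sense of the pseudo-inverse if $S$ is singular). Theorem. There is a normalization constant $C=C_{d,k,s_1,\dots,s_k}\in(0,\infty)$ such that every Wishart-random POVM of parameters $(d,k;s_1,\dots,s_k)$ has, with respect to Lebesgue measure on the affine space $\{(m_1,\dots,m_k)\in\mathrm{Herm}_d^k:\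 \sum_j m_j=I_d\}$ (the translate of Lebesgue measure on the linear space $\{(v_1,\dots,v_k)\in\mathrm{Herm}_d^k:\ \sum_j v_j=0\}$, in a fixed normalization), the density $$\frac{\mathrm d\mathbb P}{\mathrm d\mathrm{Leb}}(m_1,\dots,m_k)=C\;\mathbf 1_{\sum_j m_j=I_d}\prod_{i=1}^k\mathbf 1_{m_i\ge 0}\,\det(m_i)^{s_i-d}.$$ -/

import Mathlib

open MeasureTheory ProbabilityTheory
open scoped ComplexOrder Matrix ENNReal NNReal

noncomputable section

/-! ### Hermitian matrices and Lebesgue measure -/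

/-- The real vector space of `d × d` complex Hermitian matrices. -/
abbrev Herm (d : ℕ) : Type := selfAdjoint (Matrix (Fin d) (Fin d) ℂ)

instance Herm.instMeasurableSpace (d : ℕ) : MeasurableSpace (Herm d) := borel _

instance Herm.instBorelSpace (d : ℕ) : BorelSpace (Herm d) := ⟨rfl⟩

instance Herm.instSecondCountableTopology (d : ℕ) : SecondCountableTopology (Herm d) := by
  have : SecondCountableTopology (Matrix (Fin d) (Fin d) ℂ) :=
    inferInstanceAs (SecondCountableTopology (Fin d → Fin d → ℂ))
  exact TopologicalSpace.Subtype.secondCountableTopology _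

instance Herm.instLocallyCompactSpace (d : ℕ) : LocallyCompactSpace (Herm d) := by
  have : LocallyCompactSpace (Matrix (Fin d) (Fin d) ℂ) :=
    inferInstanceAs (LocallyCompactSpace (Fin d → Fin d → ℂ))
  have hc : IsClosed {x : Matrix (Fin d) (Fin d) ℂ | star x = x} :=
    isClosed_eq continuous_star continuous_id
  exact (show IsClosed ((selfAdjoint (Matrix (Fin d) (Fin d) ℂ) : AddSubgroup _) :
    Set (Matrix (Fin d) (Fin d) ℂ)) from hc).isClosedEmbedding_subtypeVal.locallyCompactSpace

/-- Lebesgue measure on the space of Hermitian matrices (the translation invariant measure, in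
some normalization). -/
def lebHerm (d : ℕ) : Measure (Herm d) := Measure.addHaar

/-! ### Wishart matrices -/

/-- The standard complex Gaussian distribution: real and imaginary parts are independent, centred
Gaussian, of variance `1/2` (so that the density is `π⁻¹ exp (-|z|²)`). -/
def stdComplexGaussian : Measure ℂ :=
  ((gaussianReal 0 (1 / 2)).prod (gaussianReal 0 (1 / 2))).map fun p => (⟨p.1, p.2⟩ : ℂ)

/-- The law of an `n × d` Ginibre matrix, as the array of its i.i.d. standard complex Gaussian
entries. -/
def ginibre (n d : ℕ) : Measure (Fin n → Fin d → ℂ) :=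
  Measure.pi fun _ => Measure.pi fun _ => stdComplexGaussian

/-- The Hermitian matrix `G* G`. -/
def gram {n d : ℕ} (G : Fin n → Fin d → ℂ) : Herm d :=
  ⟨(Matrix.of G)ᴴ * Matrix.of G, Matrix.isHermitian_conjTranspose_mul_self _⟩

/-- The law of `G* G`, where `G` is an `n × d` Ginibre matrix. -/
def wishartGinibre (n d : ℕ) : Measure (Herm d) := (ginibre n d).map gram

/-- The function `1_{w ≥ 0} det(w)^a` of a Hermitian matrix `w`. -/
def posDetPow {d : ℕ} (a : ℝ) : Herm d → ℝ :=
  Set.indicator {w | (w : Matrix (Fin d) (Fin d) ℂ).PosSemidef}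
    fun w => (w : Matrix (Fin d) (Fin d) ℂ).det.re ^ a

/-- The unnormalized measure `1_{w ≥ 0} exp(-Tr w) det(w)^(s-d) dw`. -/
def wishartWeight (d : ℕ) (s : ℝ) : Measure (Herm d) :=
  (lebHerm d).withDensity fun w => ENNReal.ofReal
    (Real.exp (-(w : Matrix (Fin d) (Fin d) ℂ).trace.re) * posDetPow (s - d) w)

/-- The probability measure proportional to `1_{w ≥ 0} exp(-Tr w) det(w)^(s-d) dw`. -/
def wishartReal (d : ℕ) (s : ℝ) : Measure (Herm d) :=
  (wishartWeight d s Set.univ)⁻¹ • wishartWeight d s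

/-- `μ` is the Wishart distribution with parameters `(d, s)`. For an integer `s = n` this is the law
of `G* G` with `G` an `n × d` Ginibre matrix; for a real `s ≥ d` it is the law with density
proportional to `1_{w ≥ 0} exp(-Tr w) det(w)^(s-d)`. Both definitions are admitted where both make
sense. -/
def IsWishartLaw (d : ℕ) (s : ℝ) (μ : Measure (Herm d)) : Prop :=
  (∃ n : ℕ, s = n ∧ μ = wishartGinibre n d) ∨ ((d : ℝ) ≤ s ∧ μ = wishartReal d s)

/-! ### Wishart-random POVMs -/

/-- `S^(-1/2)`, by functional calculus, for a positive semidefinite matrix `S` (inverted on the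
orthogonal complement of the kernel only, if `S` is singular). -/
def invSqrt {d : ℕ} (S : Herm d) : Herm d :=
  ⟨cfc (fun x : ℝ => (√x)⁻¹) (S : Matrix (Fin d) (Fin d) ℂ), cfc_predicate _ _⟩

/-- The matrix product `A W A` of Hermitian matrices. -/
def sandwich {d : ℕ} (A W : Herm d) : Herm d :=
  ⟨(A : Matrix (Fin d) (Fin d) ℂ) * W * A, by
    have h := W.2.conjugate (A : Matrix (Fin d) (Fin d) ℂ)
    rwa [selfAdjoint.mem_iff.mp A.2] at h⟩

/-- `M` is a Wishart-random POVM of parameters `(d, k; s_1, …, s_k)`: `M_i = S^(-1/2) W_i S^(-1/2)`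
almost surely, where `S = ∑ j, W_j` and the `W_j` are independent Wishart matrices of parameters
`(d, s_j)`. -/
def IsWishartPOVM {d k : ℕ} (s : Fin k → ℝ) {Ω : Type*} [MeasurableSpace Ω] (P : Measure Ω)
    (M : Ω → Fin k → Herm d) : Prop :=
  ∃ W : Fin k → Ω → Herm d,
    (∀ i, ∃ μ, IsWishartLaw d (s i) μ ∧ HasLaw (W i) μ P) ∧
    iIndepFun W P ∧
    ∀ᵐ ω ∂P, ∀ i, M ω i = sandwich (invSqrt (∑ j, W j ω)) (W i ω)

/-! ### Lebesgue measure on the affine space of tuples with sum `I` -/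

/-- The real vector space of `k`-tuples of Hermitian matrices with sum `0`. -/
def zeroSum (d k : ℕ) : Submodule ℝ (Fin k → Herm d) where
  carrier := {v | ∑ j, v j = 0}
  zero_mem' := by simp
  add_mem' := by
    intro a b ha hb
    simp only [Set.mem_ofPred_eq] at ha hb
    simp [Finset.sum_add_distrib, ha, hb]
  smul_mem' := by
    intro c a ha
    simp only [Set.mem_ofPred_eq] at ha
    simp [← Finset.smul_sum, ha]

instance zeroSum.instLocallyCompactSpace (d k : ℕ) : LocallyCompactSpace (zeroSum d k) := by
  have hc : IsClosed {v : Fin k → Herm d | ∑ j, v j = 0} :=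
    isClosed_eq (continuous_finsetSum _ fun i _ => continuous_apply i) continuous_const
  exact (show IsClosed ((zeroSum d k : Submodule ℝ _) : Set (Fin k → Herm d)) from
    hc).isClosedEmbedding_subtypeVal.locallyCompactSpace

/-- Lebesgue measure on the affine space of `k`-tuples of Hermitian matrices with sum `I`, for
`k ≥ 1`, seen as a measure on all `k`-tuples: the image of Lebesgue measure on the space of `k`-tuples
with sum `0` under the translation by `(I/k, …, I/k)`. -/
def lebSumOne (d k : ℕ) : Measure (Fin k → Herm d) :=
  (Measure.addHaar : Measure (zeroSum d k)).map
    fun v : zeroSum d k => (v : Fin k → Herm d) + fun _ => (k : ℝ)⁻¹ • (1 : Herm d)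

open Classical in
/-- The function `1_{∑ m_j = I} ∏ i, 1_{m_i ≥ 0} det(m_i)^(s_i - d)`. -/
def povmDensity {d k : ℕ} (s : Fin k → ℝ) (m : Fin k → Herm d) : ℝ :=
  (if ∑ j, m j = 1 then 1 else 0) * ∏ i, posDetPow (s i - d) (m i)

end

/-!
Two observations carry the proof.

*The law of the normalized tuple.* By independence, the tuple `(W_1, …, W_k)` has density
proportional to `∏ i, 1_{w_i ≥ 0} exp(-Tr w_i) det(w_i)^(s_i - d)`. A tuple is the same thing as its
sum `S` together with a zero-sum tuple, and Lebesgue measure is a product in these coordinates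
(`exists_lintegral_pi_lebHerm_eq`). For a fixed positive definite `S`, substitute
`w_i = S^(1/2) m_i S^(1/2)`, where `∑ i, m_i = I`. The exponential factor becomes `exp(-Tr S)`, the
determinants contribute a power of `det S`, and the Jacobian of the substitution on zero-sum tuples
is again a power of `det S` (`abs_det_sandwichZeroSumₗ_sqrtHerm`). So the density factors into a
function of `S` and `∏ i, 1_{m_i ≥ 0} det(m_i)^(s_i - d)`, while the normalized tuple is `m` itself
(`lintegral_zeroSum_normalizeTuple`). Integrating over `S` leaves a constant
(`exists_lintegral_normalizeTuple`). It is positive and finite because the law of the normalized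
tuple is a probability measure. Singular sums `S` are negligible (`ae_det_ne_zero`).

*Gaussian Wishart matrices.* For an integer `n ≥ d`, the law of `G* G` has to be identified with the
density `1_{w ≥ 0} exp(-Tr w) det(w)^(n - d)`. For positive definite `Q`, the substitutions
`G ↦ G Q^(1/2)` and `w ↦ Q^(1/2) w Q^(1/2)` show that both laws have Laplace transform `det(Q)⁻ⁿ` at
`Q - I` (`lintegral_exp_wishartGinibre`, `lintegral_exp_wishartWeight`). Laplace transforms near `0`
determine the characteristic function by analytic continuation, hence the law
(`ext_of_lintegral_exp_trace`).

Both parts rest on the Jacobian `(det B)^(2d)` of `X ↦ B X B` on Hermitian matrices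
(`abs_det_sandwichₗ`).
-/

noncomputable section

/-! ### Linear changes of variables -/

instance Herm.instContinuousSMul (d : ℕ) : ContinuousSMul ℝ (Herm d) :=
  ⟨(continuous_fst.smul (continuous_subtype_val.comp continuous_snd)).subtype_mk _⟩

instance Herm.instFiniteDimensional (d : ℕ) : FiniteDimensional ℝ (Herm d) :=
  FiniteDimensional.of_injective (selfAdjoint.submodule ℝ (Matrix (Fin d) (Fin d) ℂ)).subtype
    Subtype.val_injective

instance lebHerm.instIsAddHaarMeasure (d : ℕ) : (lebHerm d).IsAddHaarMeasure := by
  unfold lebHerm; infer_instance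

/-- Linear change of variables for a Haar measure on a finite-dimensional real topological vector
space, which carries no distinguished norm. -/
lemma lintegral_eq_det_mul_lintegral_comp {E : Type*} [AddCommGroup E] [Module ℝ E]
    [TopologicalSpace E] [IsTopologicalAddGroup E] [ContinuousSMul ℝ E] [T2Space E]
    [FiniteDimensional ℝ E] [MeasurableSpace E] [BorelSpace E] (μ : Measure E)
    [μ.IsAddHaarMeasure] (f : E →ₗ[ℝ] E) (hf : LinearMap.det f ≠ 0) (g : E → ℝ≥0∞) :
    ∫⁻ x, g x ∂μ = ENNReal.ofReal |LinearMap.det f| * ∫⁻ x, g (f x) ∂μ := by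
  let e : E ≃L[ℝ] (Fin (Module.finrank ℝ E) → ℝ) :=
    (Module.finBasis ℝ E).equivFun.toContinuousLinearEquiv
  let ν := μ.map e
  have : ν.IsAddHaarMeasure := e.isAddHaarMeasure_map μ
  let em : E ≃ᵐ (Fin (Module.finrank ℝ E) → ℝ) := e.toHomeomorph.toMeasurableEquiv
  let f' : (Fin (Module.finrank ℝ E) → ℝ) →ₗ[ℝ] (Fin (Module.finrank ℝ E) → ℝ) :=
    e.toLinearEquiv.toLinearMap ∘ₗ f ∘ₗ e.symm.toLinearEquiv.toLinearMap
  have hdet : LinearMap.det f' = LinearMap.det f := LinearMap.det_conj f e.toLinearEquiv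
  have hf' : LinearMap.det f' ≠ 0 := hdet ▸ hf
  have h1 : ∀ h : E → ℝ≥0∞, ∫⁻ x, h x ∂μ = ∫⁻ y, h (e.symm y) ∂ν := by
    intro h
    rw [show ν = μ.map em from rfl, lintegral_map_equiv]
    simp [em]
  rw [h1, h1]
  have h2 := Measure.map_linearMap_addHaar_eq_smul_addHaar ν hf'
  let f'e := (LinearEquiv.ofIsUnitDet (f := f') (v := Pi.basisFun ℝ _) (v' := Pi.basisFun ℝ _)
    (by rw [LinearMap.det_toMatrix]; exact hf'.isUnit)).toContinuousLinearEquiv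
  let fm : (Fin (Module.finrank ℝ E) → ℝ) ≃ᵐ (Fin (Module.finrank ℝ E) → ℝ) :=
    f'e.toHomeomorph.toMeasurableEquiv
  have hfm : (fm : (Fin (Module.finrank ℝ E) → ℝ) → (Fin (Module.finrank ℝ E) → ℝ)) = f' := rfl
  have h3 : ∫⁻ y, g (e.symm (f' y)) ∂ν = ENNReal.ofReal |(LinearMap.det f')⁻¹| *
      ∫⁻ y, g (e.symm y) ∂ν := by
    have := lintegral_map_equiv (μ := ν) (fun y => g (e.symm y)) fm
    rw [hfm, h2, lintegral_smul_measure] at this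
    exact this.symm
  have h4 : ∀ y, e.symm (f' y) = f (e.symm y) := by simp [f']
  simp only [h4] at h3
  rw [h3, ← mul_assoc, ← hdet, ← ENNReal.ofReal_mul (abs_nonneg _), ← abs_mul,
    mul_inv_cancel₀ hf']
  simp

/-- The linear map `X ↦ B X B` on Hermitian matrices, for Hermitian `B`. -/
def sandwichₗ {d : ℕ} (B : Herm d) : Herm d →ₗ[ℝ] Herm d where
  toFun := sandwich B
  map_add' X Y := Subtype.ext (by simp [sandwich, mul_add, add_mul])
  map_smul' c X := Subtype.ext (by simp [sandwich])

/-- Right multiplication of an array of `n` rows by a square matrix, as a real linear map. -/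
def rowMulₗ (n : ℕ) {d : ℕ} (B : Matrix (Fin d) (Fin d) ℂ) :
    (Fin n → Fin d → ℂ) →ₗ[ℝ] (Fin n → Fin d → ℂ) :=
  LinearMap.pi fun i => (B.vecMulLinear.restrictScalars ℝ) ∘ₗ LinearMap.proj i

/-- The map acts on each row separately, and the real determinant of a complex linear map is the
squared modulus of its complex determinant. -/
lemma det_rowMulₗ (n : ℕ) {d : ℕ} (B : Matrix (Fin d) (Fin d) ℂ) :
    LinearMap.det (rowMulₗ n B) = Complex.normSq B.det ^ n := by
  have h : LinearMap.det (B.vecMulLinear.restrictScalars ℝ) = Complex.normSq B.det := by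
    have hB : B.vecMulLinear = Matrix.toLin' Bᵀ := by
      refine LinearMap.ext fun x => ?_
      simp [Matrix.mulVec_transpose]
    rw [LinearMap.det_restrictScalars, Algebra.norm_complex_eq, hB, LinearMap.det_toLin',
      Matrix.det_transpose]
    rfl
  rw [rowMulₗ, LinearMap.det_pi]
  simp [h]

/-- The real determinant of `X ↦ A X B` on all complex matrices. -/
lemma det_mulSandwich {d : ℕ} (A B : Matrix (Fin d) (Fin d) ℂ) :
    LinearMap.det (LinearMap.mulLeft ℝ A ∘ₗ LinearMap.mulRight ℝ B) =
      Complex.normSq A.det ^ d * Complex.normSq B.det ^ d := by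
  have hR : ∀ B : Matrix (Fin d) (Fin d) ℂ,
      LinearMap.det (LinearMap.mulRight ℝ B) = Complex.normSq B.det ^ d := by
    intro B
    rw [← det_rowMulₗ]
    rfl
  have hL : LinearMap.mulLeft ℝ A = (Matrix.transposeLinearEquiv (Fin d) (Fin d) ℝ ℂ).toLinearMap ∘ₗ
      LinearMap.mulRight ℝ Aᵀ ∘ₗ
      (Matrix.transposeLinearEquiv (Fin d) (Fin d) ℝ ℂ).symm.toLinearMap := by
    ext1 X
    simp [Matrix.transpose_mul]
  rw [LinearMap.det_comp, hL, LinearMap.det_conj, hR, hR, Matrix.det_transpose]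

/-- The decomposition `X + i Y` of a matrix into Hermitian matrices `X` and `Y`. -/
def hermProdEquiv (d : ℕ) : (Herm d × Herm d) ≃ₗ[ℝ] Matrix (Fin d) (Fin d) ℂ where
  toFun p := p.1 + Complex.I • (p.2 : Matrix (Fin d) (Fin d) ℂ)
  map_add' p q := by simp only [Prod.fst_add, Prod.snd_add, AddSubgroup.coe_add, smul_add]; abel
  map_smul' c p := by simp [smul_comm Complex.I c]
  invFun X := (realPart X, imaginaryPart X)
  left_inv p := by
    ext1
    · simp
    · simp
  right_inv X := realPart_add_I_smul_imaginaryPart X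

/-- A matrix is a pair of Hermitian matrices, so the determinant of `X ↦ B X B` on Hermitian
matrices is a square root of its determinant on all matrices. -/
lemma abs_det_sandwichₗ {d : ℕ} (B : Herm d) :
    |LinearMap.det (sandwichₗ B)| = Complex.normSq (B : Matrix (Fin d) (Fin d) ℂ).det ^ d := by
  have h1 : LinearMap.mulLeft ℝ (B : Matrix (Fin d) (Fin d) ℂ) ∘ₗ
      LinearMap.mulRight ℝ (B : Matrix (Fin d) (Fin d) ℂ) =
      (hermProdEquiv d).toLinearMap ∘ₗ (LinearMap.prodMap (sandwichₗ B) (sandwichₗ B)) ∘ₗ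
        (hermProdEquiv d).symm.toLinearMap := by
    refine LinearMap.ext fun X => ?_
    obtain ⟨p, rfl⟩ := (hermProdEquiv d).surjective X
    simp [hermProdEquiv, sandwichₗ, sandwich, mul_add, add_mul, mul_assoc]
  have h2 := det_mulSandwich (B : Matrix (Fin d) (Fin d) ℂ) B
  rw [h1, LinearMap.det_conj, LinearMap.det_prodMap] at h2
  have h0 := Complex.normSq_nonneg (B : Matrix (Fin d) (Fin d) ℂ).det
  rw [← abs_of_nonneg (pow_nonneg h0 d)]
  exact (sq_eq_sq_iff_abs_eq_abs _ _).1 (by rw [sq, sq, h2])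

/-! ### Square roots, determinants and traces of Hermitian matrices -/

/-- The positive square root of a positive semidefinite Hermitian matrix. -/
def sqrtHerm {d : ℕ} (S : Herm d) : Herm d :=
  ⟨cfc Real.sqrt (S : Matrix (Fin d) (Fin d) ℂ), cfc_predicate _ _⟩

section Matrix
variable {d : ℕ}

lemma Matrix.PosDef.pos_of_mem_spectrum {S : Matrix (Fin d) (Fin d) ℂ} (hS : S.PosDef) {x : ℝ}
    (hx : x ∈ spectrum ℝ S) : 0 < x := by
  rw [hS.isHermitian.spectrum_real_eq_range_eigenvalues] at hx
  obtain ⟨i, rfl⟩ := hx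
  exact hS.eigenvalues_pos i

lemma sqrtHerm_mul_self {S : Herm d} (hS : (S : Matrix (Fin d) (Fin d) ℂ).PosDef) :
    (sqrtHerm S : Matrix (Fin d) (Fin d) ℂ) * sqrtHerm S = S := by
  have hc : ContinuousOn Real.sqrt (spectrum ℝ (S : Matrix (Fin d) (Fin d) ℂ)) :=
    Real.continuous_sqrt.continuousOn
  change cfc Real.sqrt _ * cfc Real.sqrt _ = _
  rw [← cfc_mul Real.sqrt Real.sqrt _ hc hc]
  conv_rhs => rw [← cfc_id ℝ (S : Matrix (Fin d) (Fin d) ℂ) S.2]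
  exact cfc_congr fun x hx => Real.mul_self_sqrt (hS.pos_of_mem_spectrum hx).le

lemma invSqrt_mul_sqrtHerm {S : Herm d} (hS : (S : Matrix (Fin d) (Fin d) ℂ).PosDef) :
    (invSqrt S : Matrix (Fin d) (Fin d) ℂ) * sqrtHerm S = 1 := by
  have hc : ContinuousOn Real.sqrt (spectrum ℝ (S : Matrix (Fin d) (Fin d) ℂ)) :=
    Real.continuous_sqrt.continuousOn
  have hpos : ∀ x ∈ spectrum ℝ (S : Matrix (Fin d) (Fin d) ℂ), √x ≠ 0 := fun x hx =>
    (Real.sqrt_pos.2 (hS.pos_of_mem_spectrum hx)).ne'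
  change cfc (fun x : ℝ => (√x)⁻¹) _ * cfc Real.sqrt _ = _
  rw [← cfc_mul (fun x : ℝ => (√x)⁻¹) Real.sqrt _ (hc.inv₀ hpos) hc]
  conv_rhs => rw [← cfc_one ℝ (S : Matrix (Fin d) (Fin d) ℂ) S.2]
  exact cfc_congr fun x hx => inv_mul_cancel₀ (hpos x hx)

lemma sqrtHerm_mul_invSqrt {S : Herm d} (hS : (S : Matrix (Fin d) (Fin d) ℂ).PosDef) :
    (sqrtHerm S : Matrix (Fin d) (Fin d) ℂ) * invSqrt S = 1 :=
  mul_eq_one_comm.1 (invSqrt_mul_sqrtHerm hS)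

lemma Herm.det_eq_ofReal_re (S : Herm d) :
    (S : Matrix (Fin d) (Fin d) ℂ).det = ((S : Matrix (Fin d) (Fin d) ℂ).det.re : ℂ) := by
  have h : star (S : Matrix (Fin d) (Fin d) ℂ).det = (S : Matrix (Fin d) (Fin d) ℂ).det := by
    rw [← Matrix.det_conjTranspose]
    exact congrArg Matrix.det S.2
  exact (Complex.conj_eq_iff_re.1 h).symm

lemma Herm.det_re_nonneg {S : Herm d} (hS : (S : Matrix (Fin d) (Fin d) ℂ).PosSemidef) :
    0 ≤ (S : Matrix (Fin d) (Fin d) ℂ).det.re := (Complex.le_def.1 hS.det_nonneg).1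

lemma Herm.det_re_pos {S : Herm d} (hS : (S : Matrix (Fin d) (Fin d) ℂ).PosDef) :
    0 < (S : Matrix (Fin d) (Fin d) ℂ).det.re := (Complex.lt_def.1 hS.det_pos).1

/-- `det (S^(1/2))` is a real number with square `det S`. -/
lemma normSq_det_sqrtHerm {S : Herm d} (hS : (S : Matrix (Fin d) (Fin d) ℂ).PosDef) :
    Complex.normSq (sqrtHerm S : Matrix (Fin d) (Fin d) ℂ).det =
      (S : Matrix (Fin d) (Fin d) ℂ).det.re := by
  have h := congrArg Matrix.det (sqrtHerm_mul_self hS)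
  rw [Matrix.det_mul, Herm.det_eq_ofReal_re (sqrtHerm S), ← Complex.ofReal_mul] at h
  rw [← h, Complex.ofReal_re, Herm.det_eq_ofReal_re (sqrtHerm S), Complex.normSq_ofReal,
    Complex.ofReal_re]

lemma isUnit_sqrtHerm {S : Herm d} (hS : (S : Matrix (Fin d) (Fin d) ℂ).PosDef) :
    IsUnit (sqrtHerm S : Matrix (Fin d) (Fin d) ℂ) :=
  IsUnit.of_mul_eq_one _ (sqrtHerm_mul_invSqrt hS)

lemma sandwich_sqrtHerm_one {S : Herm d} (hS : (S : Matrix (Fin d) (Fin d) ℂ).PosDef) :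
    sandwich (sqrtHerm S) 1 = S :=
  Subtype.ext (by simp [sandwich, sqrtHerm_mul_self hS])

lemma sandwich_invSqrt_sandwich_sqrtHerm {S : Herm d}
    (hS : (S : Matrix (Fin d) (Fin d) ℂ).PosDef) (X : Herm d) :
    sandwich (invSqrt S) (sandwich (sqrtHerm S) X) = X := by
  refine Subtype.ext ?_
  simp only [sandwich]
  rw [← mul_assoc, ← mul_assoc, invSqrt_mul_sqrtHerm hS, one_mul, mul_assoc,
    sqrtHerm_mul_invSqrt hS, mul_one]

lemma trace_sandwich (B X : Herm d) :
    (sandwich B X : Matrix (Fin d) (Fin d) ℂ).trace =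
      ((B : Matrix (Fin d) (Fin d) ℂ) * B * X).trace := by
  simp only [sandwich]
  rw [Matrix.trace_mul_comm, mul_assoc]

lemma posSemidef_sandwich_iff {B : Herm d} (hB : IsUnit (B : Matrix (Fin d) (Fin d) ℂ))
    (X : Herm d) : (sandwich B X : Matrix (Fin d) (Fin d) ℂ).PosSemidef ↔
      (X : Matrix (Fin d) (Fin d) ℂ).PosSemidef := by
  have h := Matrix.IsUnit.posSemidef_star_left_conjugate_iff (x := (X : Matrix (Fin d) (Fin d) ℂ)) hB
  rwa [show star (B : Matrix (Fin d) (Fin d) ℂ) = B from B.2] at h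

lemma posDetPow_nonneg (a : ℝ) (w : Herm d) : 0 ≤ posDetPow a w :=
  Set.indicator_nonneg (fun _ hw => Real.rpow_nonneg (Herm.det_re_nonneg hw) _) _

lemma posDetPow_of_posSemidef (a : ℝ) {w : Herm d}
    (hw : (w : Matrix (Fin d) (Fin d) ℂ).PosSemidef) :
    posDetPow a w = (w : Matrix (Fin d) (Fin d) ℂ).det.re ^ a :=
  Set.indicator_of_mem (s := {w : Herm d | (w : Matrix (Fin d) (Fin d) ℂ).PosSemidef}) hw _

lemma posDetPow_of_not_posSemidef (a : ℝ) {w : Herm d}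
    (hw : ¬ (w : Matrix (Fin d) (Fin d) ℂ).PosSemidef) : posDetPow a w = 0 :=
  Set.indicator_of_notMem (s := {w : Herm d | (w : Matrix (Fin d) (Fin d) ℂ).PosSemidef}) hw _

/-- `1_{w ≥ 0} det(w)^a` is relatively invariant under `w ↦ B w B`. -/
lemma posDetPow_sandwich (a : ℝ) {B : Herm d} (hB : IsUnit (B : Matrix (Fin d) (Fin d) ℂ))
    (w : Herm d) : posDetPow a (sandwich B w) =
      Complex.normSq (B : Matrix (Fin d) (Fin d) ℂ).det ^ a * posDetPow a w := by
  by_cases hw : (w : Matrix (Fin d) (Fin d) ℂ).PosSemidef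
  · rw [posDetPow_of_posSemidef a hw,
      posDetPow_of_posSemidef a ((posSemidef_sandwich_iff hB w).2 hw),
      ← Real.mul_rpow (Complex.normSq_nonneg _) (Herm.det_re_nonneg hw)]
    congr 1
    simp only [sandwich, Matrix.det_mul]
    rw [Herm.det_eq_ofReal_re B, Herm.det_eq_ofReal_re w, Complex.normSq_ofReal]
    norm_cast
    ring
  · rw [posDetPow_of_not_posSemidef a hw,
      posDetPow_of_not_posSemidef a (mt (posSemidef_sandwich_iff hB w).1 hw), mul_zero]

lemma continuous_sandwich : Continuous fun p : Herm d × Herm d => sandwich p.1 p.2 :=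
  (((continuous_subtype_val.comp continuous_fst).mul
    (continuous_subtype_val.comp continuous_snd)).mul
      (continuous_subtype_val.comp continuous_fst)).subtype_mk _

lemma continuous_det_re : Continuous fun w : Herm d => (w : Matrix (Fin d) (Fin d) ℂ).det.re :=
  Complex.continuous_re.comp continuous_subtype_val.matrix_det

lemma continuous_trace_re :
    Continuous fun w : Herm d => (w : Matrix (Fin d) (Fin d) ℂ).trace.re :=
  Complex.continuous_re.comp continuous_subtype_val.matrix_trace

lemma isClosed_posSemidef :
    IsClosed {w : Herm d | (w : Matrix (Fin d) (Fin d) ℂ).PosSemidef} := by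
  have h : {w : Herm d | (w : Matrix (Fin d) (Fin d) ℂ).PosSemidef} =
      ⋂ x : Fin d → ℂ, {w : Herm d | 0 ≤ star x ⬝ᵥ ((w : Matrix (Fin d) (Fin d) ℂ) *ᵥ x)} := by
    ext w
    simp only [Matrix.posSemidef_iff_dotProduct_mulVec, Set.mem_iInter, Set.mem_ofPred_eq]
    exact ⟨fun h x => h.2 x, fun h => ⟨w.2, h⟩⟩
  rw [h]
  refine isClosed_iInter fun x => isClosed_le continuous_const ?_
  exact continuous_const.dotProduct (continuous_subtype_val.matrix_mulVec continuous_const)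

lemma measurableSet_posSemidef :
    MeasurableSet {w : Herm d | (w : Matrix (Fin d) (Fin d) ℂ).PosSemidef} :=
  isClosed_posSemidef.measurableSet

lemma measurableSet_posDef :
    MeasurableSet {w : Herm d | (w : Matrix (Fin d) (Fin d) ℂ).PosDef} := by
  have h : {w : Herm d | (w : Matrix (Fin d) (Fin d) ℂ).PosDef} =
      {w : Herm d | (w : Matrix (Fin d) (Fin d) ℂ).PosSemidef} ∩
        {w : Herm d | (w : Matrix (Fin d) (Fin d) ℂ).det.re ≠ 0} := by
    ext w
    simp only [Set.mem_inter_iff, Set.mem_ofPred_eq]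
    refine ⟨fun h => ⟨h.posSemidef, (Herm.det_re_pos h).ne'⟩, fun h => ?_⟩
    refine h.1.posDef_iff_det_ne_zero.2 fun h0 => h.2 ?_
    rw [h0, Complex.zero_re]
  rw [h]
  exact measurableSet_posSemidef.inter
    (measurableSet_eq_fun continuous_det_re.measurable measurable_const).compl

lemma measurable_posDetPow (a : ℝ) : Measurable (posDetPow a : Herm d → ℝ) :=
  (continuous_det_re.measurable.pow_const a).indicator measurableSet_posSemidef

open scoped Matrix.Norms.L2Operator in
lemma continuousOn_invSqrt :
    ContinuousOn (invSqrt : Herm d → Herm d) {S | (S : Matrix (Fin d) (Fin d) ℂ).PosDef} := by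
  rw [Topology.IsInducing.subtypeVal.continuousOn_iff]
  refine ContinuousOn.cfc_of_mem_nhdsSet (s := Set.Ioi 0) (p := IsSelfAdjoint)
    (a := fun S : Herm d => (S : Matrix (Fin d) (Fin d) ℂ)) (fun x : ℝ => (√x)⁻¹) ?_ ?_ ?_ ?_
  · rw [isOpen_Ioi.mem_nhdsSet]
    simp only [Set.iUnion_subset_iff]
    exact fun S hS x hx => Matrix.PosDef.pos_of_mem_spectrum hS hx
  · exact continuous_subtype_val.continuousOn
  · exact fun S _ => S.2
  · exact Real.continuous_sqrt.continuousOn.inv₀ fun x hx => (Real.sqrt_pos.2 hx).ne'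

open scoped Matrix.Norms.L2Operator in
/-- A line in the direction of the identity meets the set of singular matrices in finitely many
points, so this set is negligible. -/
lemma ae_det_ne_zero : ∀ᵐ w : Herm d ∂lebHerm d, (w : Matrix (Fin d) (Fin d) ℂ).det.re ≠ 0 := by
  refine ae_mem_of_ae_add_linearMap_mem (LinearMap.toSpanSingleton ℝ (Herm d) 1) volume (lebHerm d)
    (s := {w : Herm d | (w : Matrix (Fin d) (Fin d) ℂ).det.re ≠ 0})
    (measurableSet_eq_fun continuous_det_re.measurable measurable_const).compl fun y => ?_
  -- `det (y + t I)` is the value at `t` of the characteristic polynomial of `-y`.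
  let p := (-(y : Matrix (Fin d) (Fin d) ℂ)).charpoly
  have hp : p ≠ 0 := (Matrix.charpoly_monic _).ne_zero
  have hfin : {t : ℝ | (t : ℂ) ∈ {z | p.IsRoot z}}.Finite :=
    (Polynomial.finite_setOfPred_isRoot hp).preimage Complex.ofReal_injective.injOn
  filter_upwards [hfin.countable.ae_notMem volume] with t ht h0
  refine ht ?_
  have h1 : ((y + t • (1 : Herm d) : Herm d) : Matrix (Fin d) (Fin d) ℂ).det = 0 := by
    rw [Herm.det_eq_ofReal_re]
    exact_mod_cast h0
  change p.eval (t : ℂ) = 0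
  rw [Matrix.eval_charpoly, ← h1]
  congr 1
  ext i j
  simp [Matrix.scalar_apply, Matrix.one_apply, Matrix.diagonal_apply]
  ring

lemma Herm.trace_re_eq_sum_eigenvalues (w : Herm d) :
    (w : Matrix (Fin d) (Fin d) ℂ).trace.re =
      ∑ i, Matrix.IsHermitian.eigenvalues (A := (w : Matrix (Fin d) (Fin d) ℂ)) w.2 i := by
  rw [Matrix.IsHermitian.trace_eq_sum_eigenvalues (A := (w : Matrix (Fin d) (Fin d) ℂ)) w.2]
  simp

lemma Herm.eigenvalues_le_trace_re {w : Herm d}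
    (hw : (w : Matrix (Fin d) (Fin d) ℂ).PosSemidef) (i : Fin d) :
    hw.1.eigenvalues i ≤ (w : Matrix (Fin d) (Fin d) ℂ).trace.re := by
  rw [Herm.trace_re_eq_sum_eigenvalues]
  exact Finset.single_le_sum (f := hw.1.eigenvalues) (fun j _ => hw.eigenvalues_nonneg j)
    (Finset.mem_univ i)

lemma Herm.trace_re_nonneg {w : Herm d} (hw : (w : Matrix (Fin d) (Fin d) ℂ).PosSemidef) :
    0 ≤ (w : Matrix (Fin d) (Fin d) ℂ).trace.re := (Complex.le_def.1 hw.trace_nonneg).1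

open scoped Matrix.Norms.L2Operator in
lemma norm_le_trace_re {w : Herm d} (hw : (w : Matrix (Fin d) (Fin d) ℂ).PosSemidef) :
    ‖w‖ ≤ (w : Matrix (Fin d) (Fin d) ℂ).trace.re := by
  change ‖(w : Matrix (Fin d) (Fin d) ℂ)‖ ≤ _
  conv_lhs => rw [← cfc_id ℝ (w : Matrix (Fin d) (Fin d) ℂ) w.2]
  refine norm_cfc_le (Herm.trace_re_nonneg hw) fun x hx => ?_
  rw [hw.1.spectrum_real_eq_range_eigenvalues] at hx
  obtain ⟨i, rfl⟩ := hx
  rw [id, Real.norm_of_nonneg (hw.eigenvalues_nonneg i)]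
  exact Herm.eigenvalues_le_trace_re hw i

lemma det_re_le_trace_re_pow {w : Herm d} (hw : (w : Matrix (Fin d) (Fin d) ℂ).PosSemidef) :
    (w : Matrix (Fin d) (Fin d) ℂ).det.re ≤ (w : Matrix (Fin d) (Fin d) ℂ).trace.re ^ d := by
  have h : (w : Matrix (Fin d) (Fin d) ℂ).det.re = ∏ i, hw.1.eigenvalues i := by
    rw [hw.1.det_eq_prod_eigenvalues]
    norm_cast
  rw [h]
  refine (Finset.prod_le_prod (fun i _ => hw.eigenvalues_nonneg i)
    fun i _ => Herm.eigenvalues_le_trace_re hw i).trans ?_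
  simp

open scoped Matrix.Norms.L2Operator in
lemma posDef_one_add {w : Herm d} (hw : ‖w‖ < 1) :
    ((1 + w : Herm d) : Matrix (Fin d) (Fin d) ℂ).PosDef := by
  have hH : ((1 + w : Herm d) : Matrix (Fin d) (Fin d) ℂ).IsHermitian := (1 + w).2
  refine hH.posDef_iff_eigenvalues_pos.2 fun i => ?_
  have : Nontrivial (Matrix (Fin d) (Fin d) ℂ) := by
    have : Nonempty (Fin d) := ⟨i⟩
    infer_instance
  have h1 : hH.eigenvalues i - 1 ∈ spectrum ℝ (w : Matrix (Fin d) (Fin d) ℂ) := by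
    have h2 : hH.eigenvalues i ∈ spectrum ℝ ((1 + w : Herm d) : Matrix (Fin d) (Fin d) ℂ) :=
      hH.eigenvalues_mem_spectrum_real i
    rw [spectrum.mem_iff] at h2 ⊢
    convert h2 using 2
    simp only [map_sub, map_one, AddSubgroup.coe_add, selfAdjoint.val_one]
    abel
  have h3 := spectrum.norm_le_norm_mul_of_mem h1
  rw [CStarRing.norm_one, mul_one] at h3
  have h4 := (abs_lt.1 (h3.trans_lt hw)).1
  linarith
end Matrix

/-! ### Densities of product measures and of Ginibre matrices -/

lemma lintegral_fin_prod_eq_prod {n : ℕ} {α : Type*} [MeasurableSpace α] (μ : Fin n → Measure α)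
    [∀ i, SigmaFinite (μ i)] (f : Fin n → α → ℝ≥0∞) (hf : ∀ i, Measurable (f i)) :
    ∫⁻ x, ∏ i, f i (x i) ∂Measure.pi μ = ∏ i, ∫⁻ x, f i x ∂μ i := by
  induction n with
  | zero => simp
  | succ n ih =>
    have h : Measurable fun x : Fin n → α => ∏ i : Fin n, f i.succ (x i) :=
      Finset.measurable_prod _ fun i _ => (hf i.succ).comp (measurable_pi_apply i)
    rw [Fin.prod_univ_succ, ← ih (fun i => μ i.succ) (fun i => f i.succ) fun i => hf _,
      ← lintegral_prod_mul (hf 0).aemeasurable h.aemeasurable,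
      ← ((measurePreserving_piFinSuccAbove μ 0).symm).lintegral_comp_emb
        (MeasurableEquiv.measurableEmbedding _)]
    simp_rw [MeasurableEquiv.piFinSuccAbove_symm_apply, Fin.insertNthEquiv,
      Fin.prod_univ_succ, Fin.insertNth_zero, Equiv.coe_fn_mk, Fin.cons_succ,
      Fin.zero_succAbove, Fin.cons_zero]
    rfl

lemma pi_withDensity {n : ℕ} {α : Type*} [MeasurableSpace α] (μ : Fin n → Measure α)
    [∀ i, SigmaFinite (μ i)] (f : Fin n → α → ℝ≥0∞) (hf : ∀ i, Measurable (f i))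
    [∀ i, SigmaFinite ((μ i).withDensity (f i))] :
    Measure.pi (fun i => (μ i).withDensity (f i)) =
      (Measure.pi μ).withDensity fun x => ∏ i, f i (x i) := by
  refine Measure.pi_eq fun s hs => ?_
  rw [withDensity_apply _ (MeasurableSet.univ_pi hs), Measure.restrict_pi_pi,
    lintegral_fin_prod_eq_prod _ f hf]
  exact Finset.prod_congr rfl fun i _ => (withDensity_apply _ (hs i)).symm

lemma stdComplexGaussian_eq_withDensity :
    stdComplexGaussian = (volume : Measure ℂ).withDensity
      fun z => ENNReal.ofReal (Real.pi⁻¹ * Real.exp (-Complex.normSq z)) := by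
  have h1 : (gaussianReal 0 (1 / 2)) = volume.withDensity
      fun x => ENNReal.ofReal ((√Real.pi)⁻¹ * Real.exp (-(x * x))) := by
    rw [gaussianReal_of_var_ne_zero _ (by norm_num)]
    congr 1
    ext x
    simp only [gaussianPDF, gaussianPDFReal]
    push_cast
    congr 3
    · congr 1; ring
    · ring_nf
  have hm : Measurable fun x : ℝ => ENNReal.ofReal ((√Real.pi)⁻¹ * Real.exp (-(x * x))) := by
    fun_prop
  rw [stdComplexGaussian, h1, prod_withDensity hm hm]
  have h2 : (fun p : ℝ × ℝ => (⟨p.1, p.2⟩ : ℂ)) = Complex.measurableEquivRealProd.symm := rfl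
  ext s hs
  rw [h2, MeasurableEquiv.map_apply, withDensity_apply _ hs, withDensity_apply _
    (Complex.measurableEquivRealProd.symm.measurable hs),
    ← (Complex.volume_preserving_equiv_real_prod.symm).setLIntegral_comp_preimage_emb
      (MeasurableEquiv.measurableEmbedding _)]
  refine lintegral_congr fun p => ?_
  rw [← ENNReal.ofReal_mul (by positivity)]
  congr 1
  rw [mul_mul_mul_comm, ← mul_inv, Real.mul_self_sqrt Real.pi_pos.le, ← Real.exp_add]
  simp [Complex.normSq_apply, Complex.measurableEquivRealProd]
  ring

/-- `Tr (G* G)` is the squared Frobenius norm of `G`, so it is the exponent of the Gaussian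
density. -/
lemma trace_gram {n d : ℕ} (G : Fin n → Fin d → ℂ) :
    (gram G : Matrix (Fin d) (Fin d) ℂ).trace.re = ∑ i, ∑ j, Complex.normSq (G i j) := by
  simp only [gram, Matrix.trace, Matrix.diag, Matrix.mul_apply, Matrix.conjTranspose_apply,
    Matrix.of_apply, Complex.re_sum]
  rw [Finset.sum_comm]
  refine Finset.sum_congr rfl fun i _ => Finset.sum_congr rfl fun j _ => ?_
  simp [Complex.normSq_apply]

lemma ginibre_eq_withDensity (n d : ℕ) :
    ginibre n d = (volume : Measure (Fin n → Fin d → ℂ)).withDensity fun G =>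
      ENNReal.ofReal (((Real.pi⁻¹) ^ d) ^ n *
        Real.exp (-(gram G : Matrix (Fin d) (Fin d) ℂ).trace.re)) := by
  have hm : Measurable fun z : ℂ => ENNReal.ofReal (Real.pi⁻¹ * Real.exp (-Complex.normSq z)) := by
    have : Continuous Complex.normSq := Complex.continuous_normSq
    fun_prop
  have h1 : (Measure.pi fun _ : Fin d => stdComplexGaussian) =
      (volume : Measure (Fin d → ℂ)).withDensity fun v =>
        ENNReal.ofReal ((Real.pi⁻¹) ^ d * Real.exp (-∑ j, Complex.normSq (v j))) := by
    simp_rw [stdComplexGaussian_eq_withDensity]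
    rw [pi_withDensity _ _ fun _ => hm, volume_pi]
    congr 1
    ext v
    rw [← ENNReal.ofReal_prod_of_nonneg fun _ _ => by positivity, Finset.prod_mul_distrib,
      ← Real.exp_sum]
    simp
  have hm2 : Measurable fun v : Fin d → ℂ =>
      ENNReal.ofReal ((Real.pi⁻¹) ^ d * Real.exp (-∑ j, Complex.normSq (v j))) := by
    have : Continuous Complex.normSq := Complex.continuous_normSq
    fun_prop
  simp_rw [ginibre, h1]
  rw [pi_withDensity _ _ fun _ => hm2, volume_pi]
  congr 1
  ext G
  rw [← ENNReal.ofReal_prod_of_nonneg fun _ _ => by positivity, Finset.prod_mul_distrib,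
    ← Real.exp_sum, trace_gram]
  simp

instance stdComplexGaussian.instIsProbabilityMeasure : IsProbabilityMeasure stdComplexGaussian :=
  Measure.isProbabilityMeasure_map (by
    have := Complex.measurableEquivRealProd.symm.measurable
    exact this.aemeasurable)

instance ginibre.instIsProbabilityMeasure (n d : ℕ) : IsProbabilityMeasure (ginibre n d) := by
  unfold ginibre; infer_instance

lemma continuous_gram {n d : ℕ} : Continuous (gram : (Fin n → Fin d → ℂ) → Herm d) := by
  have h : Continuous fun G : Fin n → Fin d → ℂ => Matrix.of G := continuous_id
  exact (h.matrix_conjTranspose.matrix_mul h).subtype_mk _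

/-! ### Laplace transforms of Wishart matrices -/

lemma measurable_exp_trace_re_mul {d : ℕ} (A : Matrix (Fin d) (Fin d) ℂ) :
    Measurable fun w : Herm d => ENNReal.ofReal (Real.exp (A * w).trace.re) :=
  ENNReal.measurable_ofReal.comp (Real.continuous_exp.comp (Complex.continuous_re.comp
    (continuous_const.matrix_mul continuous_subtype_val).matrix_trace)).measurable

lemma gram_rowMulₗ {n d : ℕ} (B : Herm d) (G : Fin n → Fin d → ℂ) :
    gram (rowMulₗ n (B : Matrix (Fin d) (Fin d) ℂ) G) = sandwich B (gram G) := by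
  have h1 : Matrix.of (rowMulₗ n (B : Matrix (Fin d) (Fin d) ℂ) G) =
      Matrix.of G * (B : Matrix (Fin d) (Fin d) ℂ) := rfl
  have h2 : (B : Matrix (Fin d) (Fin d) ℂ)ᴴ = B := B.2
  refine Subtype.ext ?_
  simp only [gram, sandwich, h1, Matrix.conjTranspose_mul, h2, mul_assoc, Matrix.mul_assoc]

/-- The Laplace transform at `Q - 1` of the law of `G* G`, for an `n × d` Ginibre matrix `G`, is
`det(Q)⁻ⁿ`: substitute `G Q^(1/2)` for `G` in the Gaussian integral. -/
lemma lintegral_exp_wishartGinibre {n d : ℕ} {Q : Herm d}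
    (hQ : (Q : Matrix (Fin d) (Fin d) ℂ).PosDef) :
    ENNReal.ofReal ((Q : Matrix (Fin d) (Fin d) ℂ).det.re ^ n) *
      ∫⁻ w, ENNReal.ofReal (Real.exp ((1 - Q : Matrix (Fin d) (Fin d) ℂ) * w).trace.re)
        ∂wishartGinibre n d = 1 := by
  have hdet := det_rowMulₗ n (sqrtHerm Q : Matrix (Fin d) (Fin d) ℂ)
  rw [normSq_det_sqrtHerm hQ] at hdet
  have hpos := pow_pos (Herm.det_re_pos hQ) n
  have hg : Measurable fun G : Fin n → Fin d → ℂ => ENNReal.ofReal (((Real.pi⁻¹) ^ d) ^ n *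
        Real.exp (-(gram G : Matrix (Fin d) (Fin d) ℂ).trace.re)) := by
    have := (continuous_trace_re.comp (continuous_gram (n := n) (d := d))).measurable
    simp only [Function.comp_def] at this
    fun_prop
  have hexp := measurable_exp_trace_re_mul (1 - (Q : Matrix (Fin d) (Fin d) ℂ))
  have hexp_gram : Measurable fun G : Fin n → Fin d → ℂ =>
      ENNReal.ofReal (Real.exp ((1 - (Q : Matrix (Fin d) (Fin d) ℂ)) * gram G).trace.re) :=
    hexp.comp continuous_gram.measurable
  have hvol : (volume : Measure (Fin n → Fin d → ℂ)).IsAddHaarMeasure := by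
    have : (volume : Measure (Fin d → ℂ)).IsAddHaarMeasure := by
      rw [volume_pi]; infer_instance
    exact Measure.pi.isAddHaarMeasure _
  rw [wishartGinibre, lintegral_map hexp
    continuous_gram.measurable]
  have h1 : ∫⁻ _, 1 ∂ginibre n d = 1 := by simp
  rw [ginibre_eq_withDensity, lintegral_withDensity_eq_lintegral_mul _ hg measurable_const,
    lintegral_eq_det_mul_lintegral_comp _
    (rowMulₗ n (sqrtHerm Q : Matrix (Fin d) (Fin d) ℂ)) (hdet ▸ hpos.ne'), hdet,
    abs_of_pos hpos] at h1
  rw [ginibre_eq_withDensity, lintegral_withDensity_eq_lintegral_mul _ hg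
    hexp_gram]
  refine Eq.trans ?_ h1
  congr 1
  refine lintegral_congr fun G => ?_
  simp only [Pi.mul_apply, mul_one]
  rw [← ENNReal.ofReal_mul (by positivity), mul_assoc, ← Real.exp_add, gram_rowMulₗ,
    trace_sandwich, sqrtHerm_mul_self hQ]
  congr 3
  rw [sub_mul, one_mul, Matrix.trace_sub, Complex.sub_re]
  ring

/-- The Laplace transform at `Q - 1` of the measure `1_{w ≥ 0} exp(-Tr w) det(w)^(s-d) dw` is
`det(Q)^(-s)` times its total mass: substitute `Q^(1/2) w Q^(1/2)` for `w`. -/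
lemma lintegral_exp_wishartWeight {d : ℕ} {Q : Herm d} (s : ℝ)
    (hQ : (Q : Matrix (Fin d) (Fin d) ℂ).PosDef) :
    ENNReal.ofReal ((Q : Matrix (Fin d) (Fin d) ℂ).det.re ^ s) *
      ∫⁻ w, ENNReal.ofReal (Real.exp ((1 - Q : Matrix (Fin d) (Fin d) ℂ) * w).trace.re)
        ∂wishartWeight d s = wishartWeight d s Set.univ := by
  have hdet := abs_det_sandwichₗ (sqrtHerm Q)
  rw [normSq_det_sqrtHerm hQ] at hdet
  have hQ0 := Herm.det_re_pos hQ
  have hg : Measurable fun w : Herm d => ENNReal.ofReal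
      (Real.exp (-(w : Matrix (Fin d) (Fin d) ℂ).trace.re) * posDetPow (s - d) w) := by
    have h1 := (continuous_trace_re (d := d)).measurable
    have h2 := measurable_posDetPow (d := d) (s - d)
    fun_prop
  have hexp := measurable_exp_trace_re_mul (1 - (Q : Matrix (Fin d) (Fin d) ℂ))
  have hchange := lintegral_eq_det_mul_lintegral_comp (lebHerm d) (sandwichₗ (sqrtHerm Q))
    (abs_pos.1 (hdet ▸ pow_pos hQ0 d)) fun w => ENNReal.ofReal
      (Real.exp (-(w : Matrix (Fin d) (Fin d) ℂ).trace.re) * posDetPow (s - d) w)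
  rw [hdet] at hchange
  rw [wishartWeight, lintegral_withDensity_eq_lintegral_mul _ hg
    hexp, withDensity_apply _ MeasurableSet.univ,
    Measure.restrict_univ, hchange]
  have hsplit : (Q : Matrix (Fin d) (Fin d) ℂ).det.re ^ s =
      (Q : Matrix (Fin d) (Fin d) ℂ).det.re ^ d *
        (Q : Matrix (Fin d) (Fin d) ℂ).det.re ^ (s - d) := by
    rw [← Real.rpow_natCast, ← Real.rpow_add hQ0]; congr 1; ring
  rw [hsplit, ENNReal.ofReal_mul (by positivity), mul_assoc]
  congr 1
  rw [← lintegral_const_mul' _ _ ENNReal.ofReal_ne_top]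
  refine lintegral_congr fun w => ?_
  have hw := posDetPow_nonneg (s - d) w
  change _ = ENNReal.ofReal
    (Real.exp (-(sandwich (sqrtHerm Q) w : Matrix (Fin d) (Fin d) ℂ).trace.re) *
    posDetPow (s - d) (sandwich (sqrtHerm Q) w))
  simp only [Pi.mul_apply]
  rw [← ENNReal.ofReal_mul (by positivity), ← ENNReal.ofReal_mul (by positivity),
    posDetPow_sandwich _ (isUnit_sqrtHerm hQ), trace_sandwich, sqrtHerm_mul_self hQ,
    normSq_det_sqrtHerm hQ]
  congr 1
  rw [show -((Q : Matrix (Fin d) (Fin d) ℂ) * w).trace.re =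
    -(w : Matrix (Fin d) (Fin d) ℂ).trace.re + ((1 - Q : Matrix (Fin d) (Fin d) ℂ) * w).trace.re by
      rw [sub_mul, one_mul, Matrix.trace_sub, Complex.sub_re]; ring, Real.exp_add]
  ring

/-! ### The two definitions of the Wishart distribution agree -/

lemma integrable_exp_mul_of_lintegral_ne_top {Ω : Type*} [MeasurableSpace Ω] {μ : Measure Ω}
    {X : Ω → ℝ} (hX : Measurable X) {t : ℝ}
    (h : ∫⁻ x, ENNReal.ofReal (Real.exp (t * X x)) ∂μ ≠ ∞) :
    Integrable (fun x => Real.exp (t * X x)) μ := by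
  refine ⟨(hX.const_mul t).exp.aestronglyMeasurable, ?_⟩
  rw [hasFiniteIntegral_iff_ofReal (ae_of_all _ fun x => (Real.exp_pos _).le)]
  exact lt_top_iff_ne_top.2 h

open Filter Topology in
/-- The moment generating function near `0` determines the complex moment generating function on
a vertical strip, by analytic continuation. -/
lemma complexMGF_I_eq_of_lintegral_exp_eq {Ω Ω' : Type*} [MeasurableSpace Ω] [MeasurableSpace Ω']
    {μ : Measure Ω} {ν : Measure Ω'} {X : Ω → ℝ} {Y : Ω' → ℝ} (hX : Measurable X)
    (hY : Measurable Y)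
    (h : ∀ᶠ t : ℝ in 𝓝 0, ∫⁻ x, ENNReal.ofReal (Real.exp (t * X x)) ∂μ =
      ∫⁻ y, ENNReal.ofReal (Real.exp (t * Y y)) ∂ν)
    (hfin : ∀ᶠ t : ℝ in 𝓝 0, ∫⁻ x, ENNReal.ofReal (Real.exp (t * X x)) ∂μ ≠ ∞) :
    complexMGF X μ Complex.I = complexMGF Y ν Complex.I := by
  have hint : ∀ᶠ t : ℝ in 𝓝 0, t ∈ integrableExpSet X μ := by
    filter_upwards [hfin] with t ht using integrable_exp_mul_of_lintegral_ne_top hX ht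
  have hint' : ∀ᶠ t : ℝ in 𝓝 0, t ∈ integrableExpSet Y ν := by
    filter_upwards [h, hfin] with t h1 h2
      using integrable_exp_mul_of_lintegral_ne_top hY (h1 ▸ h2)
  have h0X : (0 : ℝ) ∈ interior (integrableExpSet X μ) := mem_interior_iff_mem_nhds.2 hint
  have h0Y : (0 : ℝ) ∈ interior (integrableExpSet Y ν) := mem_interior_iff_mem_nhds.2 hint'
  let U : Set ℝ := interior (integrableExpSet X μ) ∩ interior (integrableExpSet Y ν)
  have hU : IsPreconnected {z : ℂ | z.re ∈ U} :=
    ((convex_integrableExpSet.interior.inter convex_integrableExpSet.interior).linear_preimage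
      Complex.reLm).isPreconnected
  refine AnalyticOnNhd.eqOn_of_preconnected_of_frequently_eq (U := {z : ℂ | z.re ∈ U})
    (z₀ := ((0 : ℝ) : ℂ)) (fun z hz => analyticAt_complexMGF hz.1)
    (fun z hz => analyticAt_complexMGF hz.2) hU ⟨h0X, h0Y⟩ ?_ (x := Complex.I)
    ⟨by simpa using h0X, by simpa using h0Y⟩
  have hreal : ∀ᶠ t : ℝ in 𝓝[≠] 0, complexMGF X μ (t : ℂ) = complexMGF Y ν (t : ℂ) := by
    filter_upwards [h.filter_mono nhdsWithin_le_nhds] with t ht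
    rw [complexMGF_ofReal, complexMGF_ofReal, mgf, mgf,
      integral_eq_lintegral_of_nonneg_ae (ae_of_all _ fun x => (Real.exp_pos _).le)
        (hX.const_mul t).exp.aestronglyMeasurable,
      integral_eq_lintegral_of_nonneg_ae (ae_of_all _ fun x => (Real.exp_pos _).le)
        (hY.const_mul t).exp.aestronglyMeasurable, ht]
  have htend : Tendsto (fun t : ℝ => (t : ℂ)) (𝓝[≠] 0) (𝓝[≠] ((0 : ℝ) : ℂ)) := by
    refine tendsto_nhdsWithin_iff.2 ⟨?_, ?_⟩
    · exact (Complex.continuous_ofReal.tendsto 0).mono_left nhdsWithin_le_nhds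
    · filter_upwards [self_mem_nhdsWithin] with t ht
      simpa using ht
  exact htend.frequently hreal.frequently

section Wishart
variable {d : ℕ}

/-- The real inner product `Re Tr (v w)` on Hermitian matrices. -/
def traceForm (d : ℕ) : Herm d →ₗ[ℝ] Herm d →ₗ[ℝ] ℝ :=
  LinearMap.mk₂ ℝ (fun v w => ((w : Matrix (Fin d) (Fin d) ℂ) * v).trace.re)
    (by intros; simp [mul_add]) (by intros; simp) (by intros; simp [add_mul]) (by intros; simp)

lemma traceForm_apply (v w : Herm d) :
    traceForm d v w = ((w : Matrix (Fin d) (Fin d) ℂ) * v).trace.re := rfl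

lemma traceForm_ne_zero {v : Herm d} (hv : v ≠ 0) : traceForm d v ≠ 0 := by
  intro h
  refine hv (Subtype.ext ?_)
  have h1 : ((v : Matrix (Fin d) (Fin d) ℂ)ᴴ * v).trace = 0 := by
    have h2 : ((v : Matrix (Fin d) (Fin d) ℂ)ᴴ * v).trace.re = 0 := by
      rw [show (v : Matrix (Fin d) (Fin d) ℂ)ᴴ = v from v.2]
      exact LinearMap.congr_fun h v
    have h3 := (Complex.le_def.1
      (Matrix.posSemidef_conjTranspose_mul_self (v : Matrix (Fin d) (Fin d) ℂ)).trace_nonneg).2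
    exact Complex.ext h2 h3.symm
  exact Matrix.trace_conjTranspose_mul_self_eq_zero_iff.1 h1

lemma continuous_traceForm : Continuous fun p : Herm d × Herm d => traceForm d p.1 p.2 :=
  Complex.continuous_re.comp ((continuous_subtype_val.comp continuous_snd).matrix_mul
    (continuous_subtype_val.comp continuous_fst)).matrix_trace

open scoped Matrix.Norms.L2Operator in
/-- Finite measures on Hermitian matrices whose Laplace transforms are finite and coincide near `0`
are equal. -/
lemma ext_of_lintegral_exp_trace {μ ν : Measure (Herm d)} [IsFiniteMeasure μ] [IsFiniteMeasure ν]
    (h : ∀ Q : Herm d, (Q : Matrix (Fin d) (Fin d) ℂ).PosDef →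
      ∫⁻ w, ENNReal.ofReal (Real.exp ((1 - Q : Matrix (Fin d) (Fin d) ℂ) * w).trace.re) ∂μ =
      ∫⁻ w, ENNReal.ofReal (Real.exp ((1 - Q : Matrix (Fin d) (Fin d) ℂ) * w).trace.re) ∂ν)
    (hfin : ∀ Q : Herm d, (Q : Matrix (Fin d) (Fin d) ℂ).PosDef →
      ∫⁻ w, ENNReal.ofReal (Real.exp ((1 - Q : Matrix (Fin d) (Fin d) ℂ) * w).trace.re) ∂μ ≠ ∞) :
    μ = ν := by
  refine ext_of_integral_char_eq Real.continuous_probChar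
    Real.probChar_ne_one (L := traceForm d) (fun v hv => traceForm_ne_zero hv)
    continuous_traceForm fun θ => ?_
  have hm : Measurable fun w : Herm d => traceForm d w θ :=
    (continuous_traceForm.comp (continuous_id.prodMk continuous_const)).measurable
  have hpd : ∀ᶠ t : ℝ in nhds 0,
      ((1 + (-t) • θ : Herm d) : Matrix (Fin d) (Fin d) ℂ).PosDef := by
    have hc : Continuous fun t : ℝ => ‖(-t) • θ‖ := by fun_prop
    have h1 : ∀ᶠ t : ℝ in nhds 0, ‖(-t) • θ‖ < 1 :=
      (hc.tendsto 0).eventually_lt_const (by simp)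
    filter_upwards [h1] with t ht using posDef_one_add ht
  have hrw : ∀ (t : ℝ) (w : Herm d), ((1 - (1 + (-t) • θ : Herm d) :
      Matrix (Fin d) (Fin d) ℂ) * w).trace.re = t * traceForm d w θ := by
    intro t w
    rw [traceForm_apply]
    simp
  have key := complexMGF_I_eq_of_lintegral_exp_eq (μ := μ) (ν := ν) hm hm
    (by filter_upwards [hpd] with t ht
        simpa only [hrw] using h _ ht)
    (by filter_upwards [hpd] with t ht
        simpa only [hrw] using hfin _ ht)
  simp only [complexMGF] at key
  simpa [BoundedContinuousFunction.char_apply, Real.probChar_apply, mul_comm] using key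

/-- The exponential beats every power of the trace, which dominates the determinant, so the Wishart
density decays faster than any power of `x ≤ Tr w`; it will be applied to the norm `x` of `w`. -/
lemma exp_neg_mul_posDetPow_le {a : ℝ} (ha : 0 ≤ a) (w : Herm d) (r : ℕ) {x : ℝ} (hx : 0 ≤ x)
    (hxw : (w : Matrix (Fin d) (Fin d) ℂ).PosSemidef → x ≤ (w : Matrix (Fin d) (Fin d) ℂ).trace.re) :
    Real.exp (-(w : Matrix (Fin d) (Fin d) ℂ).trace.re) * posDetPow a w ≤
      (Real.exp 1 * (⌈d * a⌉₊ + r).factorial) * (1 + x) ^ (-(r : ℝ)) := by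
  by_cases hw : (w : Matrix (Fin d) (Fin d) ℂ).PosSemidef
  swap
  · rw [posDetPow_of_not_posSemidef a hw, mul_zero]; positivity
  rw [posDetPow_of_posSemidef a hw]
  set t := (w : Matrix (Fin d) (Fin d) ℂ).trace.re
  have ht : 0 ≤ t := Herm.trace_re_nonneg hw
  have hxt := hxw hw
  set m := ⌈d * a⌉₊
  have h1 : (w : Matrix (Fin d) (Fin d) ℂ).det.re ^ a ≤ (1 + t) ^ m := by
    calc (w : Matrix (Fin d) (Fin d) ℂ).det.re ^ a
        ≤ ((1 + t) ^ d) ^ a := by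
          refine Real.rpow_le_rpow (Herm.det_re_nonneg hw) ?_ ha
          exact (det_re_le_trace_re_pow hw).trans (pow_le_pow_left₀ ht (by linarith) d)
      _ = (1 + t) ^ (d * a) := by
          rw [← Real.rpow_natCast, ← Real.rpow_mul (by linarith)]
      _ ≤ (1 + t) ^ (m : ℝ) := Real.rpow_le_rpow_of_exponent_le (by linarith) (Nat.le_ceil _)
      _ = (1 + t) ^ m := Real.rpow_natCast _ _
  have h2 : (1 + t) ^ (m + r) ≤ (m + r).factorial * (Real.exp 1 * Real.exp t) := by
    have := Real.pow_div_factorial_le_exp (x := 1 + t) (by linarith) (m + r)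
    rw [div_le_iff₀ (by positivity), Real.exp_add] at this
    linarith
  rw [Real.rpow_neg (by linarith), Real.rpow_natCast, ← div_eq_mul_inv, le_div_iff₀ (by positivity)]
  calc Real.exp (-t) * (w : Matrix (Fin d) (Fin d) ℂ).det.re ^ a * (1 + x) ^ r
      ≤ Real.exp (-t) * (1 + t) ^ m * (1 + t) ^ r := by gcongr
    _ = Real.exp (-t) * (1 + t) ^ (m + r) := by rw [pow_add]; ring
    _ ≤ Real.exp (-t) * ((m + r).factorial * (Real.exp 1 * Real.exp t)) := by gcongr
    _ = Real.exp 1 * (m + r).factorial * (Real.exp (-t) * Real.exp t) := by ring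
    _ = Real.exp 1 * (m + r).factorial := by rw [← Real.exp_add]; simp

open scoped Matrix.Norms.L2Operator in
lemma wishartWeight_univ_ne_top {s : ℝ} (hs : (d : ℝ) ≤ s) :
    wishartWeight d s Set.univ ≠ ∞ := by
  rw [wishartWeight, withDensity_apply _ MeasurableSet.univ, Measure.restrict_univ]
  have hint := (integrable_one_add_norm (E := Herm d) (μ := lebHerm d)
    (r := ((Module.finrank ℝ (Herm d) + 1 : ℕ) : ℝ)) (by push_cast; linarith)).const_mul
    (Real.exp 1 * (⌈d * (s - d)⌉₊ + (Module.finrank ℝ (Herm d) + 1)).factorial)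
  refine ne_top_of_le_ne_top hint.lintegral_lt_top.ne (lintegral_mono fun w => ?_)
  exact ENNReal.ofReal_le_ofReal
    (exp_neg_mul_posDetPow_le (sub_nonneg.2 hs) w _ (norm_nonneg w) norm_le_trace_re)

open scoped Matrix.Norms.L2Operator in
lemma wishartWeight_univ_ne_zero (s : ℝ) : wishartWeight d s Set.univ ≠ 0 := by
  intro h0
  have hball : (lebHerm d) (Metric.ball 1 1) ≠ 0 := by
    exact (Metric.isOpen_ball.measure_pos _ ⟨1, by simp⟩).ne'
  refine hball ?_
  have hm : Measurable fun w : Herm d => ENNReal.ofReal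
      (Real.exp (-(w : Matrix (Fin d) (Fin d) ℂ).trace.re) * posDetPow (s - d) w) := by
    have h1 := (continuous_trace_re (d := d)).measurable
    have h2 := measurable_posDetPow (d := d) (s - d)
    fun_prop
  rw [wishartWeight, withDensity_apply _ MeasurableSet.univ, Measure.restrict_univ,
    lintegral_eq_zero_iff hm] at h0
  refine measure_mono_null (fun w hw => ?_) h0
  have hpd : (w : Matrix (Fin d) (Fin d) ℂ).PosDef := by
    have := posDef_one_add (w := w - 1) (by rwa [mem_ball_iff_norm] at hw)
    rwa [add_sub_cancel] at this
  simp only [Set.mem_compl_iff, Set.mem_ofPred_eq, Pi.zero_apply, ENNReal.ofReal_eq_zero, not_le]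
  rw [posDetPow_of_posSemidef _ hpd.posSemidef]
  exact mul_pos (Real.exp_pos _) (Real.rpow_pos_of_pos (Herm.det_re_pos hpd) _)

lemma isProbabilityMeasure_wishartReal {s : ℝ} (hs : (d : ℝ) ≤ s) :
    IsProbabilityMeasure (wishartReal d s) :=
  ⟨by rw [wishartReal, Measure.smul_apply, smul_eq_mul,
    ENNReal.inv_mul_cancel (wishartWeight_univ_ne_zero s) (wishartWeight_univ_ne_top hs)]⟩

/-- For integers `n ≥ d` the two definitions of the Wishart distribution agree, because both laws
have Laplace transform `det(Q)⁻ⁿ` at `Q - 1`. -/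
lemma wishartGinibre_eq_wishartReal {n : ℕ} (hn : d ≤ n) :
    wishartGinibre n d = wishartReal d n := by
  have hn' : (d : ℝ) ≤ (n : ℝ) := by exact_mod_cast hn
  have : IsProbabilityMeasure (wishartReal d n) := isProbabilityMeasure_wishartReal hn'
  have : IsProbabilityMeasure (wishartGinibre n d) :=
    Measure.isProbabilityMeasure_map continuous_gram.measurable.aemeasurable
  have hG : ∀ Q : Herm d, (Q : Matrix (Fin d) (Fin d) ℂ).PosDef →
      ∫⁻ w, ENNReal.ofReal (Real.exp ((1 - Q : Matrix (Fin d) (Fin d) ℂ) * w).trace.re)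
        ∂wishartGinibre n d =
        (ENNReal.ofReal ((Q : Matrix (Fin d) (Fin d) ℂ).det.re ^ n))⁻¹ := fun Q hQ =>
    ENNReal.eq_inv_of_mul_eq_one_left ((mul_comm _ _).trans (lintegral_exp_wishartGinibre hQ))
  refine ext_of_lintegral_exp_trace (fun Q hQ => ?_) fun Q hQ => ?_
  · rw [hG Q hQ]
    refine (ENNReal.eq_inv_of_mul_eq_one_left ?_).symm
    rw [wishartReal, lintegral_smul_measure, smul_eq_mul, mul_assoc,
      mul_comm _ (ENNReal.ofReal _), ← Real.rpow_natCast,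
      lintegral_exp_wishartWeight _ hQ,
      ENNReal.inv_mul_cancel (wishartWeight_univ_ne_zero _) (wishartWeight_univ_ne_top hn')]
  · rw [hG Q hQ]
    exact ENNReal.inv_ne_top.2 (ENNReal.ofReal_pos.2 (pow_pos (Herm.det_re_pos hQ) n)).ne'

lemma IsWishartLaw.eq_wishartReal {s : ℝ} (hs : (d : ℝ) ≤ s) {μ : Measure (Herm d)}
    (h : IsWishartLaw d s μ) : μ = wishartReal d s := by
  obtain ⟨n, rfl, rfl⟩ | ⟨-, rfl⟩ := h
  · exact wishartGinibre_eq_wishartReal (by exact_mod_cast hs)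
  · rfl
end Wishart

section POVM
variable {d k : ℕ}

/-! ### Separating the sum of a tuple from the normalized tuple -/

instance zeroSum.instSFiniteAddHaar (d k : ℕ) :
    SFinite (Measure.addHaar : Measure (zeroSum d k)) := by
  have h1 : SecondCountableTopology (zeroSum d k) :=
    TopologicalSpace.Subtype.secondCountableTopology _
  have h2 : SigmaCompactSpace (zeroSum d k) := sigmaCompactSpace_of_locallyCompact_secondCountable
  have h3 : SigmaFinite (Measure.addHaar : Measure (zeroSum d k)) := inferInstance
  infer_instance

lemma sum_zeroSum (v : zeroSum d k) : ∑ j, (v : Fin k → Herm d) j = 0 := v.2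

/-- A `k`-tuple of Hermitian matrices corresponds to its sum `S` and the zero-sum tuple obtained by
subtracting `S / k` from every entry. -/
def zeroSumProdEquiv (d : ℕ) {k : ℕ} (hk : 1 ≤ k) :
    (zeroSum d k × Herm d) ≃ₗ[ℝ] (Fin k → Herm d) where
  toFun p := (p.1 : Fin k → Herm d) + fun _ => (k : ℝ)⁻¹ • p.2
  map_add' p q := by
    ext1 i
    simp only [Prod.fst_add, Prod.snd_add, Submodule.coe_add, smul_add, Pi.add_apply]
    abel
  map_smul' c p := by ext1 i; simp [smul_comm c]
  invFun w := (⟨w - fun _ => (k : ℝ)⁻¹ • ∑ j, w j, by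
    have hk' : (k : ℝ) ≠ 0 := by exact_mod_cast (by omega : k ≠ 0)
    change ∑ i, (w i - (k : ℝ)⁻¹ • ∑ j, w j) = 0
    rw [Finset.sum_sub_distrib, Finset.sum_const, Finset.card_univ, Fintype.card_fin,
      ← Nat.cast_smul_eq_nsmul ℝ, smul_smul, mul_inv_cancel₀ hk', one_smul, sub_self]⟩, ∑ j, w j)
  left_inv p := by
    have hk' : (k : ℝ) ≠ 0 := by exact_mod_cast (by omega : k ≠ 0)
    have hs : ∑ j, ((p.1 : Fin k → Herm d) j + (k : ℝ)⁻¹ • p.2) = p.2 := by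
      rw [Finset.sum_add_distrib, sum_zeroSum, zero_add, Finset.sum_const, Finset.card_univ,
        Fintype.card_fin, ← Nat.cast_smul_eq_nsmul ℝ, smul_smul, mul_inv_cancel₀ hk', one_smul]
    refine Prod.ext (Subtype.ext ?_) hs
    ext1 i
    simp only [Pi.add_apply, Pi.sub_apply, hs, add_sub_cancel_right]
  right_inv w := by ext1 i; simp

lemma zeroSumProdEquiv_apply (hk : 1 ≤ k) (v : zeroSum d k) (S : Herm d) (i : Fin k) :
    zeroSumProdEquiv d hk (v, S) i = (v : Fin k → Herm d) i + (k : ℝ)⁻¹ • S := rfl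

lemma sum_zeroSumProdEquiv (hk : 1 ≤ k) (v : zeroSum d k) (S : Herm d) :
    ∑ j, zeroSumProdEquiv d hk (v, S) j = S :=
  congrArg Prod.snd ((zeroSumProdEquiv d hk).symm_apply_apply (v, S))

/-- The linear map `v ↦ (B v_j B)_j` on zero-sum tuples. -/
def sandwichZeroSumₗ (k : ℕ) (B : Herm d) : zeroSum d k →ₗ[ℝ] zeroSum d k :=
  LinearMap.restrict (LinearMap.pi fun i => sandwichₗ B ∘ₗ LinearMap.proj i) fun v hv => by
    change ∑ j, sandwichₗ B (v j) = 0
    rw [← map_sum, show ∑ j, v j = 0 from hv, map_zero]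

lemma zeroSumProdEquiv_sandwich (hk : 1 ≤ k) (B : Herm d) (v : zeroSum d k) (S : Herm d)
    (i : Fin k) : zeroSumProdEquiv d hk (sandwichZeroSumₗ k B v, sandwich B S) i =
      sandwich B (zeroSumProdEquiv d hk (v, S) i) := by
  rw [zeroSumProdEquiv_apply, zeroSumProdEquiv_apply]
  change sandwichₗ B ((v : Fin k → Herm d) i) + (k : ℝ)⁻¹ • sandwichₗ B S = sandwichₗ B _
  rw [map_add, map_smul]

/-- On `k`-tuples, `w ↦ (B w_j B)_j` splits as the direct sum of its restriction to zero-sum tuples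
and of its action on the sum. -/
lemma abs_det_sandwichZeroSumₗ_mul (hk : 1 ≤ k) (B : Herm d) :
    |LinearMap.det (M := zeroSum d k) (sandwichZeroSumₗ k B)| * |LinearMap.det (sandwichₗ B)| =
      |LinearMap.det (sandwichₗ B)| ^ k := by
  have h : LinearMap.pi (fun i : Fin k => sandwichₗ B ∘ₗ LinearMap.proj i) =
      (zeroSumProdEquiv d hk).toLinearMap ∘ₗ
        LinearMap.prodMap (sandwichZeroSumₗ k B) (sandwichₗ B) ∘ₗ
        (zeroSumProdEquiv d hk).symm.toLinearMap := by
    refine LinearMap.ext fun w => ?_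
    obtain ⟨p, rfl⟩ := (zeroSumProdEquiv d hk).surjective w
    ext1 i
    simp only [LinearMap.comp_apply, LinearEquiv.coe_coe, LinearEquiv.symm_apply_apply]
    exact (zeroSumProdEquiv_sandwich hk B p.1 p.2 i).symm
  have h2 := LinearMap.det_pi fun _ : Fin k => sandwichₗ B
  rw [h, LinearMap.det_conj, LinearMap.det_prodMap] at h2
  rw [← abs_mul, h2]
  simp

lemma abs_det_sandwichZeroSumₗ_sqrtHerm (hk : 1 ≤ k) {S : Herm d}
    (hS : (S : Matrix (Fin d) (Fin d) ℂ).PosDef) :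
    |LinearMap.det (M := zeroSum d k) (sandwichZeroSumₗ k (sqrtHerm S))| =
      (S : Matrix (Fin d) (Fin d) ℂ).det.re ^ (d * (k - 1)) := by
  have h := abs_det_sandwichZeroSumₗ_mul hk (sqrtHerm S)
  have hpos := pow_pos (Herm.det_re_pos hS) d
  rw [abs_det_sandwichₗ, normSq_det_sqrtHerm hS] at h
  refine mul_right_cancel₀ hpos.ne' (h.trans ?_)
  rw [← pow_mul, ← pow_add, ← Nat.mul_succ, Nat.succ_eq_add_one, Nat.sub_add_cancel hk]

/-- Lebesgue measure on `k`-tuples is, up to a constant, the product of the Lebesgue measures on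
zero-sum tuples and on the space of the sum. -/
lemma exists_lintegral_pi_lebHerm_eq (hk : 1 ≤ k) : ∃ κ : ℝ≥0∞,
    ∀ F : (Fin k → Herm d) → ℝ≥0∞, Measurable F →
      ∫⁻ w, F w ∂(Measure.pi fun _ => lebHerm d) = κ * ∫⁻ S, ∫⁻ v,
        F (zeroSumProdEquiv d hk (v, S)) ∂(Measure.addHaar : Measure (zeroSum d k)) ∂lebHerm d := by
  let Φ : (zeroSum d k × Herm d) ≃L[ℝ] (Fin k → Herm d) :=
    (zeroSumProdEquiv d hk).toContinuousLinearEquiv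
  let ρ := (Measure.addHaar : Measure (zeroSum d k)).prod (lebHerm d)
  have : ρ.IsAddHaarMeasure := Measure.prod.instIsAddHaarMeasure _ _
  have hρ : (ρ.map Φ).IsAddHaarMeasure := Φ.isAddHaarMeasure_map ρ
  refine ⟨(Measure.pi fun _ => lebHerm d).addHaarScalarFactor (ρ.map Φ), fun F hF => ?_⟩
  have h := Measure.isAddLeftInvariant_eq_smul (Measure.pi fun _ : Fin k => lebHerm d) (ρ.map Φ)
  conv_lhs => rw [h]
  have hFΦ : Measurable fun p => F (Φ p) := hF.comp Φ.continuous.measurable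
  rw [lintegral_smul_measure, lintegral_map hF Φ.continuous.measurable,
    lintegral_prod_symm' _ hFΦ]
  rfl

/-- The density `1_{w ≥ 0} exp(-Tr w) det(w)^a` of a Wishart matrix, up to normalization. -/
def wishartDensity (a : ℝ) (w : Herm d) : ℝ≥0∞ :=
  ENNReal.ofReal (Real.exp (-(w : Matrix (Fin d) (Fin d) ℂ).trace.re) * posDetPow a w)

lemma measurable_wishartDensity (a : ℝ) : Measurable (wishartDensity a : Herm d → ℝ≥0∞) := by
  have h1 := (continuous_trace_re (d := d)).measurable
  have h2 := measurable_posDetPow (d := d) a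
  unfold wishartDensity
  fun_prop

/-- `S^(-1/2)` for positive definite `S`, and `0` otherwise. Unlike `invSqrt` it is easily seen to be
measurable. -/
def posInvSqrt : Herm d → Herm d :=
  Set.indicator {S | (S : Matrix (Fin d) (Fin d) ℂ).PosDef} invSqrt

lemma posInvSqrt_of_posDef {S : Herm d} (hS : (S : Matrix (Fin d) (Fin d) ℂ).PosDef) :
    posInvSqrt S = invSqrt S :=
  Set.indicator_of_mem (s := {S : Herm d | (S : Matrix (Fin d) (Fin d) ℂ).PosDef}) hS _

lemma measurable_posInvSqrt : Measurable (posInvSqrt : Herm d → Herm d) := by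
  classical
  rw [posInvSqrt, ← Set.piecewise_eq_indicator]
  exact continuousOn_invSqrt.measurable_piecewise continuousOn_const measurableSet_posDef

/-- The tuple `S^(-1/2) w_i S^(-1/2)`, where `S = ∑ j, w_j`. -/
def normalizeTuple (w : Fin k → Herm d) : Fin k → Herm d :=
  fun i => sandwich (posInvSqrt (∑ j, w j)) (w i)

lemma measurable_normalizeTuple_apply (i : Fin k) :
    Measurable fun w : Fin k → Herm d => normalizeTuple w i := by
  have hs : Measurable fun p : Herm d × Herm d => sandwich p.1 p.2 :=
    continuous_sandwich.measurable
  have h : Measurable fun w : Fin k → Herm d => ∑ j, w j :=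
    Finset.measurable_sum _ fun j _ => measurable_pi_apply j
  have h1 : Measurable fun w : Fin k → Herm d => posInvSqrt (∑ j, w j) :=
    measurable_posInvSqrt.comp h
  have h2 : Measurable fun w : Fin k → Herm d => (posInvSqrt (∑ j, w j), w i) :=
    h1.prodMk (measurable_pi_apply i)
  have h3 := hs.comp h2
  exact h3

lemma measurable_normalizeTuple :
    Measurable (normalizeTuple : (Fin k → Herm d) → Fin k → Herm d) :=
  measurable_pi_iff.2 measurable_normalizeTuple_apply

/-- The exponential factor depends only on the sum `S`, because `∑ i, S^(1/2) m_i S^(1/2) = S`. -/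
lemma prod_wishartDensity_sandwich (a : Fin k → ℝ) {S : Herm d}
    (hS : (S : Matrix (Fin d) (Fin d) ℂ).PosDef) {m : Fin k → Herm d} (hm : ∑ j, m j = 1) :
    ∏ i, wishartDensity (a i) (sandwich (sqrtHerm S) (m i)) =
      ENNReal.ofReal (Real.exp (-(S : Matrix (Fin d) (Fin d) ℂ).trace.re) *
        (S : Matrix (Fin d) (Fin d) ℂ).det.re ^ (∑ i, a i)) *
        ENNReal.ofReal (∏ i, posDetPow (a i) (m i)) := by
  have hS0 := Herm.det_re_pos hS
  have htr : ∑ i, (sandwich (sqrtHerm S) (m i) : Matrix (Fin d) (Fin d) ℂ).trace.re =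
      (S : Matrix (Fin d) (Fin d) ℂ).trace.re := by
    have h1 : ∑ i, sandwich (sqrtHerm S) (m i) = S := by
      change ∑ i, sandwichₗ (sqrtHerm S) (m i) = S
      rw [← map_sum, hm]
      exact sandwich_sqrtHerm_one hS
    conv_rhs => rw [← h1]
    rw [AddSubgroup.val_finsetSum, Matrix.trace_sum, Complex.re_sum]
  simp only [wishartDensity]
  rw [← ENNReal.ofReal_prod_of_nonneg fun i _ =>
      mul_nonneg (Real.exp_pos _).le (posDetPow_nonneg _ _),
    ← ENNReal.ofReal_mul (by positivity), Finset.prod_mul_distrib, ← Real.exp_sum,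
    Finset.sum_neg_distrib, htr, mul_assoc]
  simp only [posDetPow_sandwich _ (isUnit_sqrtHerm hS), normSq_det_sqrtHerm hS]
  rw [Finset.prod_mul_distrib, Real.rpow_sum_of_pos hS0]

/-- For a given positive definite sum `S`, the substitution `w_i = S^(1/2) m_i S^(1/2)` separates
`S` from the normalized tuple `m`. -/
lemma lintegral_zeroSum_normalizeTuple (hk : 1 ≤ k) (a : Fin k → ℝ)
    (F : (Fin k → Herm d) → ℝ≥0∞) {S : Herm d} (hS : (S : Matrix (Fin d) (Fin d) ℂ).PosDef) :
    ∫⁻ v, F (normalizeTuple (zeroSumProdEquiv d hk (v, S))) *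
        ∏ i, wishartDensity (a i) (zeroSumProdEquiv d hk (v, S) i)
        ∂(Measure.addHaar : Measure (zeroSum d k)) =
      ENNReal.ofReal ((S : Matrix (Fin d) (Fin d) ℂ).det.re ^ (d * (k - 1))) *
        ENNReal.ofReal (Real.exp (-(S : Matrix (Fin d) (Fin d) ℂ).trace.re) *
          (S : Matrix (Fin d) (Fin d) ℂ).det.re ^ (∑ i, a i)) *
        ∫⁻ v, F (zeroSumProdEquiv d hk (v, 1)) *
          ENNReal.ofReal (∏ i, posDetPow (a i) (zeroSumProdEquiv d hk (v, 1) i))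
          ∂(Measure.addHaar : Measure (zeroSum d k)) := by
  have hdet := abs_det_sandwichZeroSumₗ_sqrtHerm hk hS
  rw [lintegral_eq_det_mul_lintegral_comp (E := zeroSum d k) _ (sandwichZeroSumₗ k (sqrtHerm S))
    (abs_pos.1 (hdet ▸ pow_pos (Herm.det_re_pos hS) _)), hdet, mul_assoc]
  congr 1
  rw [← lintegral_const_mul' _ _ ENNReal.ofReal_ne_top]
  refine lintegral_congr fun v => ?_
  have h1 : zeroSumProdEquiv d hk (sandwichZeroSumₗ k (sqrtHerm S) v, S) =
      fun i => sandwich (sqrtHerm S) (zeroSumProdEquiv d hk (v, 1) i) := by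
    ext1 i
    rw [← zeroSumProdEquiv_sandwich, sandwich_sqrtHerm_one hS]
  have h2 : normalizeTuple (zeroSumProdEquiv d hk (sandwichZeroSumₗ k (sqrtHerm S) v, S)) =
      zeroSumProdEquiv d hk (v, 1) := by
    ext1 i
    rw [normalizeTuple, sum_zeroSumProdEquiv, posInvSqrt_of_posDef hS, h1,
      sandwich_invSqrt_sandwich_sqrtHerm hS]
  rw [h2, h1, prod_wishartDensity_sandwich a hS (sum_zeroSumProdEquiv hk v 1)]
  ring

lemma prod_wishartDensity_eq_zero (a : Fin k → ℝ) {w : Fin k → Herm d}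
    (hw : ¬ ((∑ j, w j : Herm d) : Matrix (Fin d) (Fin d) ℂ).PosSemidef) :
    ∏ i, wishartDensity (a i) (w i) = 0 := by
  by_contra h0
  refine hw ?_
  rw [AddSubgroup.val_finsetSum]
  refine Matrix.posSemidef_sum _ fun i _ => ?_
  by_contra hi
  refine h0 (Finset.prod_eq_zero (Finset.mem_univ i) ?_)
  rw [wishartDensity, posDetPow_of_not_posSemidef _ hi, mul_zero, ENNReal.ofReal_zero]

/-- Under the product of the unnormalized Wishart measures, the normalized tuple has density
`∏ i, 1_{m_i ≥ 0} det(m_i)^(a_i)`; the integral over the sum `S` only contributes the constant, which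
is not yet known to be finite. -/
lemma exists_lintegral_normalizeTuple (hk : 1 ≤ k) (a : Fin k → ℝ) : ∃ K : ℝ≥0∞,
    ∀ F : (Fin k → Herm d) → ℝ≥0∞, Measurable F →
      ∫⁻ w, F (normalizeTuple w) * ∏ i, wishartDensity (a i) (w i)
        ∂(Measure.pi fun _ => lebHerm d) =
      K * ∫⁻ v, F (zeroSumProdEquiv d hk (v, 1)) *
          ENNReal.ofReal (∏ i, posDetPow (a i) (zeroSumProdEquiv d hk (v, 1) i))
          ∂(Measure.addHaar : Measure (zeroSum d k)) := by
  obtain ⟨κ, hκ⟩ := exists_lintegral_pi_lebHerm_eq (d := d) hk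
  let h : Herm d → ℝ≥0∞ := Set.indicator {S | (S : Matrix (Fin d) (Fin d) ℂ).PosDef} fun S =>
    ENNReal.ofReal ((S : Matrix (Fin d) (Fin d) ℂ).det.re ^ (d * (k - 1))) *
        ENNReal.ofReal (Real.exp (-(S : Matrix (Fin d) (Fin d) ℂ).trace.re) *
          (S : Matrix (Fin d) (Fin d) ℂ).det.re ^ (∑ i, a i))
  have hh : Measurable h := by
    have h1 := (continuous_trace_re (d := d)).measurable
    have h2 := (continuous_det_re (d := d)).measurable
    refine Measurable.indicator ?_ measurableSet_posDef
    fun_prop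
  refine ⟨κ * ∫⁻ S, h S ∂lebHerm d, fun F hF => ?_⟩
  have hG : Measurable fun w : Fin k → Herm d =>
      F (normalizeTuple w) * ∏ i, wishartDensity (a i) (w i) :=
    (hF.comp measurable_normalizeTuple).mul (Finset.measurable_prod _ fun i _ =>
      (measurable_wishartDensity (a i)).comp (measurable_pi_apply i))
  rw [hκ _ hG, mul_assoc,
    ← lintegral_mul_const _ hh]
  congr 1
  refine lintegral_congr_ae ?_
  filter_upwards [ae_det_ne_zero] with S hdet
  by_cases hS : (S : Matrix (Fin d) (Fin d) ℂ).PosDef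
  · rw [lintegral_zeroSum_normalizeTuple hk a F hS]
    congr 1
    simp only [h]
    rw [Set.indicator_of_mem (s := {S : Herm d | (S : Matrix (Fin d) (Fin d) ℂ).PosDef}) hS]
  · have hS' : ¬ (S : Matrix (Fin d) (Fin d) ℂ).PosSemidef := fun hS' => hS
      (hS'.posDef_iff_det_ne_zero.2 fun h0 => hdet (by rw [h0, Complex.zero_re]))
    have hhS : h S = 0 := Set.indicator_of_notMem (M := ℝ≥0∞)
      (s := {S : Herm d | (S : Matrix (Fin d) (Fin d) ℂ).PosDef}) hS _
    rw [hhS, zero_mul]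
    refine (lintegral_congr fun v => ?_).trans lintegral_zero
    rw [prod_wishartDensity_eq_zero a (by rwa [sum_zeroSumProdEquiv]), mul_zero]

lemma measurable_povmDensity (s : Fin k → ℝ) :
    Measurable (povmDensity s : (Fin k → Herm d) → ℝ) := by
  refine Measurable.mul (Measurable.ite ?_ measurable_const measurable_const)
    (Finset.measurable_prod _ fun i _ =>
      (measurable_posDetPow (s i - d)).comp (measurable_pi_apply i))
  exact (isClosed_eq (continuous_finsetSum _ fun i _ => continuous_apply i)
    continuous_const).measurableSet

lemma lintegral_lebSumOne (hk : 1 ≤ k) {F : (Fin k → Herm d) → ℝ≥0∞} (hF : Measurable F) :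
    ∫⁻ m, F m ∂lebSumOne d k =
      ∫⁻ v, F (zeroSumProdEquiv d hk (v, 1)) ∂(Measure.addHaar : Measure (zeroSum d k)) := by
  have hc : Continuous fun v : zeroSum d k =>
      (v : Fin k → Herm d) + fun _ => (k : ℝ)⁻¹ • (1 : Herm d) :=
    continuous_subtype_val.add continuous_const
  rw [lebSumOne, lintegral_map hF hc.measurable]
  rfl

lemma wishartReal_eq_withDensity (s : ℝ) :
    wishartReal d s = (lebHerm d).withDensity fun w =>
      (wishartWeight d s Set.univ)⁻¹ * wishartDensity (s - d) w := by
  rw [wishartReal]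
  exact (withDensity_smul _ (measurable_wishartDensity (s - d))).symm

lemma ae_posDef_wishartReal (s : ℝ) :
    ∀ᵐ w : Herm d ∂wishartReal d s, (w : Matrix (Fin d) (Fin d) ℂ).PosDef := by
  rw [wishartReal_eq_withDensity,
    ae_withDensity_iff ((measurable_wishartDensity (s - d)).const_mul _)]
  filter_upwards [ae_det_ne_zero] with w hdet hw
  have hpsd : (w : Matrix (Fin d) (Fin d) ℂ).PosSemidef := by
    by_contra h
    refine hw ?_
    rw [wishartDensity, posDetPow_of_not_posSemidef _ h, mul_zero, ENNReal.ofReal_zero, mul_zero]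
  exact hpsd.posDef_iff_det_ne_zero.2 fun h0 => hdet (by rw [h0, Complex.zero_re])

/-- The law of the normalized tuple, with a constant that may so far be `0` or `∞`. -/
lemma exists_map_normalizeTuple_eq_smul (hk : 1 ≤ k) (s : Fin k → ℝ) (hs : ∀ i, (d : ℝ) ≤ s i) :
    ∃ C : ℝ≥0∞, (Measure.pi fun i => wishartReal d (s i)).map normalizeTuple =
      C • (lebSumOne d k).withDensity fun m => ENNReal.ofReal (povmDensity s m) := by
  obtain ⟨K, hK⟩ := exists_lintegral_normalizeTuple (d := d) hk fun i => s i - d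
  have hprob : ∀ i, IsProbabilityMeasure (wishartReal d (s i)) := fun i =>
    isProbabilityMeasure_wishartReal (hs i)
  have hpi : (Measure.pi fun i => wishartReal d (s i)) =
      (Measure.pi fun _ => lebHerm d).withDensity fun w : Fin k → Herm d =>
        ∏ i, ((wishartWeight d (s i) Set.univ)⁻¹ * wishartDensity (s i - d) (w i)) := by
    have hσ : ∀ i, SigmaFinite ((lebHerm d).withDensity fun w =>
        (wishartWeight d (s i) Set.univ)⁻¹ * wishartDensity (s i - d) w) := fun i => by
      rw [← wishartReal_eq_withDensity]; infer_instance
    simp_rw [wishartReal_eq_withDensity]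
    exact pi_withDensity _ _ fun i => (measurable_wishartDensity (s i - d)).const_mul _
  have hdens : Measurable fun w : Fin k → Herm d => ∏ i, wishartDensity (s i - d) (w i) :=
    Finset.measurable_prod _ fun i _ =>
      (measurable_wishartDensity (s i - d)).comp (measurable_pi_apply i)
  have hpd : Measurable fun m : Fin k → Herm d => ENNReal.ofReal (povmDensity s m) :=
    (measurable_povmDensity s).ennreal_ofReal
  refine ⟨(∏ i, (wishartWeight d (s i) Set.univ)⁻¹) * K, Measure.ext fun A hA => ?_⟩
  have h1 : Measurable (A.indicator (1 : (Fin k → Herm d) → ℝ≥0∞)) := measurable_one.indicator hA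
  have h2 : Measurable fun w : Fin k → Herm d =>
      A.indicator (1 : (Fin k → Herm d) → ℝ≥0∞) (normalizeTuple w) :=
    h1.comp measurable_normalizeTuple
  have h3 : Measurable fun w : Fin k → Herm d => (∏ i, wishartDensity (s i - d) (w i)) *
      A.indicator (1 : (Fin k → Herm d) → ℝ≥0∞) (normalizeTuple w) := hdens.mul h2
  rw [← lintegral_indicator_one hA, lintegral_map h1 measurable_normalizeTuple, hpi,
    Measure.smul_apply, smul_eq_mul, ← lintegral_indicator_one hA,
    lintegral_withDensity_eq_lintegral_mul _ hpd h1,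
    lintegral_lebSumOne hk (hpd.mul h1)]
  simp_rw [Finset.prod_mul_distrib]
  rw [lintegral_withDensity_eq_lintegral_mul _ (hdens.const_mul _)
    h2]
  simp only [Pi.mul_apply, mul_assoc]
  rw [lintegral_const_mul _ h3]
  congr 1
  simp only [mul_comm (∏ i, wishartDensity _ _)]
  rw [hK _ h1]
  congr 1
  refine lintegral_congr fun v => ?_
  rw [mul_comm, povmDensity, if_pos (sum_zeroSumProdEquiv hk v 1), one_mul]

lemma exists_map_normalizeTuple_eq (hk : 1 ≤ k) (s : Fin k → ℝ) (hs : ∀ i, (d : ℝ) ≤ s i) :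
    ∃ C : ℝ, 0 < C ∧ (Measure.pi fun i => wishartReal d (s i)).map normalizeTuple =
      (lebSumOne d k).withDensity fun m => ENNReal.ofReal (C * povmDensity s m) := by
  obtain ⟨C, hC⟩ := exists_map_normalizeTuple_eq_smul hk s hs
  have hprob : ∀ i, IsProbabilityMeasure (wishartReal d (s i)) := fun i =>
    isProbabilityMeasure_wishartReal (hs i)
  have hmap : IsProbabilityMeasure
      ((Measure.pi fun i => wishartReal d (s i)).map normalizeTuple) :=
    Measure.isProbabilityMeasure_map measurable_normalizeTuple.aemeasurable
  -- The left side has total mass `1`, so the constant is neither `0` nor `∞`: in `ℝ≥0∞`, the product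
  -- of `∞` with any mass is `0` or `∞`.
  have h1 := hmap.measure_univ
  rw [hC, Measure.smul_apply, smul_eq_mul] at h1
  have hC0 : C ≠ 0 := fun h => by simp [h] at h1
  have hCtop : C ≠ ∞ := fun h => by
    rw [h, mul_comm] at h1
    have h2 := ENNReal.eq_inv_of_mul_eq_one_left h1
    rw [ENNReal.inv_top] at h2
    simp [h2] at h1
  refine ⟨C.toReal, ENNReal.toReal_pos hC0 hCtop, ?_⟩
  rw [hC, ← withDensity_smul' _ _ hCtop]
  congr 1
  ext m
  rw [ENNReal.ofReal_mul ENNReal.toReal_nonneg, ENNReal.ofReal_toReal hCtop]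
  rfl

end POVM

end

theorem mainTheorem2 (d k : ℕ) (hk : 1 ≤ k) (s : Fin k → ℝ) (hs : ∀ i, (d : ℝ) ≤ s i) :
    ∃ C : ℝ, 0 < C ∧
      ∀ {Ω : Type*} [MeasurableSpace Ω] (P : Measure Ω) [IsProbabilityMeasure P]
        (M : Ω → Fin k → Herm d), IsWishartPOVM s P M →
        HasLaw M ((lebSumOne d k).withDensity fun m => ENNReal.ofReal (C * povmDensity s m)) P := by
  obtain ⟨C, hC0, hC⟩ := exists_map_normalizeTuple_eq hk s hs
  refine ⟨C, hC0, fun {Ω} _ P _ M ⟨W, hW, hind, hM⟩ => ?_⟩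
  have hlaw : ∀ i, HasLaw (W i) (wishartReal d (s i)) P := fun i => by
    obtain ⟨μ, hμ, hWμ⟩ := hW i
    exact hμ.eq_wishartReal (hs i) ▸ hWμ
  have hWm : AEMeasurable (fun ω i => W i ω) P :=
    aemeasurable_pi_lambda _ fun i => (hlaw i).aemeasurable
  have hjoint : P.map (fun ω i => W i ω) = Measure.pi fun i => wishartReal d (s i) := by
    rw [(iIndepFun_iff_map_fun_eq_pi_map fun i => (hlaw i).aemeasurable).1 hind]
    simp_rw [fun i => (hlaw i).map_eq]
  have hpos : ∀ᵐ ω ∂P, ∀ i, (W i ω : Matrix (Fin d) (Fin d) ℂ).PosDef := by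
    refine ae_all_iff.2 fun i => ae_of_ae_map
      (p := fun w : Herm d => (w : Matrix (Fin d) (Fin d) ℂ).PosDef) (hlaw i).aemeasurable ?_
    rw [(hlaw i).map_eq]
    exact ae_posDef_wishartReal (s i)
  have hMT : (fun ω => normalizeTuple fun i => W i ω) =ᵐ[P] M := by
    filter_upwards [hM, hpos] with ω hω hpω
    ext1 i
    have hS : ((∑ j, W j ω : Herm d) : Matrix (Fin d) (Fin d) ℂ).PosDef := by
      rw [AddSubgroup.val_finsetSum]
      exact Matrix.posDef_sum ⟨⟨0, hk⟩, Finset.mem_univ _⟩ fun j _ => hpω j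
    rw [hω i, normalizeTuple, posInvSqrt_of_posDef hS]
  refine ⟨(measurable_normalizeTuple.comp_aemeasurable hWm).congr hMT, ?_⟩
  rw [← Measure.map_congr hMT, ← hC, ← hjoint,
    AEMeasurable.map_map_of_aemeasurable measurable_normalizeTuple.aemeasurable hWm]
  rfl
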